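/- Let $B_k$ be Artin's braid group on $k$ strands, with generators $\sigma_1,\dots,\sigma_{k-1}$ and the relations $\sigma_i\sigma_j=\sigma_j\sigma_i$ ($|i-j|\ge 2$), $\sigma_i\sigma_{i+1}\sigma_i=\sigma_{i+1}\sigma_i\sigma_{i+1}$, and let $P_k\le B_k$ be the pure braid group, the kernel of $B_k\to\Sigma_k$. For a group $\pi$ let $\Gamma^1(\pi)=\pi$, $\Gamma^{i+1}(\pi)=[\Gamma^i(\pi),\pi]$ be its descending central series and let $\mathrm{gr}_*(\pi)=\bigoplus_{i\ge 1}\Gamma^i(\pi)/\Gamma^{i+1}(\pi)$, a Lie algebra over $\mathbb Z$ under the bracket induced by the commutator $[x,y]=xyx^{-1}y^{-1}$. A monotone map $f:\{0,\dots,m\}\to\{0,\dots,n\}$ induces a homomorphism $f^*:P_{n+1}\to P_{m+1}$ that replaces, for each $k$, the strand in position $k$ by $|f^{-1}(k)|$ parallel strands (so that faces delete and degeneracies double a strand). This makes $\mathrm{AP}_\bullet$, $\mathrm{AP}_n=P_{n+1}$, a simplicial group. For $1\le q\le n$ let $x_q\in P_{n+1}$ be the braid obtained from the full twist $A_{1,2}=\sigma_1^2\in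 P_2$ by replacing its first strand by $n+1-q$ parallel strands and its second strand by $q$ parallel strands. The cabling homomorphism is $$\Theta_n: F[y_1,\dots,y_n]\to P_{n+1},\qquad \Theta_n(y_q)=x_q,$$ where $F[y_1,\dots,y_n]$ is the free group of rank $n$. Let $F[S^1]_\bullet$ be Milnor's free simplicial group on the simplicial circle $S^1=\Delta[1]/\partial\Delta[1]$, so that $F[S^1]_n=F[y_1,\dots,y_n]$, with $y_q$ the class of the monotone map $\{0,\dots,n\}\to\{0,1\}$ that takes the value $1$ exactly $q$ times. The $\Theta_n$ are the components of a morphism of simplicial groups $\Theta:F[S^1]_\bullet\to\mathrm{AP}_\bullet$. The $E^0$-term $E^0(G_\bullet)$ of the Bousfield–Kan spectral sequence of a simplicial group $G_\bullet$ (filtered by its descending central series) is the simplicial Lie algebra $n\mapsto \mathrm{gr}_*(G_n)$. **Theorem.** For every $n\ge 0$: 1. the morphism of Lie algebras $\mathrm{gr}_*(\Theta_n):\mathrm{gr}_*(F[y_1,\dots,y_n])\to\mathrm{gr}_*(P_{n+1})$ is a monomorphism; 2. $\Theta_n$ is a monomorphism, so that $x_1,\dots,x_n$ freely generate a free subgroup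 of rank $n$ of $P_{n+1}$; 3. for every injective monotone map $i:\{0,1\}\to\{0,\dots,n\}$, the composite $i^*\circ\Theta_n: F[y_1,\dots,y_n]\to P_2$ of $\Theta_n$ with the projection that forgets all strands but two is surjective (in contrast to the standard free subgroups of rank $n$ in $P_{n+1}$, the kernels of the homomorphisms $P_{n+1}\to P_n$ that delete one strand); 4. the morphism $E^0(\Theta):E^0(F[S^1]_\bullet)\to E^0(\mathrm{AP}_\bullet)$ is injective in simplicial degree $n$. -/

import Mathlib

open CategoryTheory Opposite
open scoped DirectSum commutatorElement

section GradedLie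

variable {G H K : Type*} [Group G] [Group H] [Group K]

/-- `Gam G i` is the `(i+1)`-st stage `Γ^{i+1}(G)` of the descending central series of `G`:
`Gam G 0 = G` and `Gam G (i+1) = [Gam G i, G]`. -/
abbrev Gam (G : Type*) [Group G] (i : ℕ) : Subgroup G := (⊤ : Subgroup G).lowerCentralSeries i

lemma Gam_succ_le (i : ℕ) : Gam G (i + 1) ≤ Gam G i :=
  (⊤ : Subgroup G).lowerCentralSeries_antitone (Nat.le_succ i)

lemma Gam_comm_mem : ∀ (j i : ℕ) {x y : G}, x ∈ Gam G i → y ∈ Gam G j →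
    ⁅x, y⁆ ∈ Gam G (i + j + 1) := by
  have key : ∀ j i : ℕ, ⁅Gam G i, Gam G j⁆ ≤ Gam G (i + j + 1) := by
    intro j
    induction j with
    | zero => intro i; exact le_refl _
    | succ j ih =>
      intro i
      let N := Gam G (i + (j + 1) + 1)
      have h1 : ⁅⁅Gam G i, (⊤ : Subgroup G)⁆, Gam G j⁆ ≤ N := by
        have := ih (i + 1)
        rw [show i + 1 + j + 1 = i + (j + 1) + 1 by ring] at this
        exact this
      have h2 : ⁅⁅Gam G i, Gam G j⁆, (⊤ : Subgroup G)⁆ ≤ N :=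
        Subgroup.commutator_mono (ih i) le_rfl
      rw [Subgroup.commutator_comm]
      let q := QuotientGroup.mk' N
      have toBot : ∀ A : Subgroup G, A ≤ N ↔ A.map q = ⊥ := by
        intro A
        rw [Subgroup.map_eq_bot_iff, QuotientGroup.ker_mk']
      change ⁅⁅Gam G j, (⊤ : Subgroup G)⁆, Gam G i⁆ ≤ N
      rw [toBot] at h1 h2 ⊢
      simp only [Subgroup.map_commutator] at h1 h2 ⊢
      apply Subgroup.commutator_commutator_eq_bot_of_rotate
      · rw [Subgroup.commutator_comm (Subgroup.map q ⊤)]; exact h1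
      · exact h2
  intro j i x y hx hy
  exact key j i (Subgroup.commutator_mem_commutator hx hy)

/-- The subquotient `Γ^{i+1}(G) / Γ^{i+2}(G)`. -/
abbrev GrQuot (G : Type*) [Group G] (i : ℕ) : Type _ :=
  Gam G i ⧸ (Gam G (i + 1)).subgroupOf (Gam G i)

instance GrQuot.commGroup (i : ℕ) : CommGroup (GrQuot G i) where
  mul_comm a b := by
    induction a using QuotientGroup.induction_on with | H a => ?_
    induction b using QuotientGroup.induction_on with | H b => ?_
    rw [← QuotientGroup.mk_mul, ← QuotientGroup.mk_mul, QuotientGroup.eq,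
      Subgroup.mem_subgroupOf]
    have : ((a * b)⁻¹ * (b * a) : Gam G i).1 = ⁅(b : G)⁻¹, (a : G)⁻¹⁆ := by
      simp [commutatorElement_def, mul_assoc]
    rw [this]
    exact Subgroup.commutator_mem_commutator ((Gam G i).inv_mem b.2) (Subgroup.mem_top _)

/-- The degree `i + 1` part `gr_{i+1}(G) = Γ^{i+1}(G) / Γ^{i+2}(G)`, written additively. -/
abbrev GrPiece (G : Type*) [Group G] (i : ℕ) : Type _ := Additive (GrQuot G i)

/-- The class in `gr_{i+1}(G)` of an element of `Γ^{i+1}(G)`. -/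
def grCls (i : ℕ) (x : G) (hx : x ∈ Gam G i) : GrPiece G i :=
  Additive.ofMul (QuotientGroup.mk ⟨x, hx⟩)

lemma grCls_surj {i : ℕ} (a : GrPiece G i) : ∃ x hx, grCls i x hx = a := by
  obtain ⟨x, hx⟩ := QuotientGroup.mk_surjective (Additive.toMul a)
  exact ⟨x.1, x.2, by rw [grCls]; exact congrArg Additive.ofMul hx⟩

lemma grCls_eq {i : ℕ} {x y : G} {hx : x ∈ Gam G i} {hy : y ∈ Gam G i} :
    grCls i x hx = grCls i y hy ↔ x⁻¹ * y ∈ Gam G (i + 1) := by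
  rw [grCls, grCls, Additive.ofMul.injective.eq_iff, QuotientGroup.eq, Subgroup.mem_subgroupOf]
  rfl

lemma grCls_mul {i : ℕ} {x y : G} (hx : x ∈ Gam G i) (hy : y ∈ Gam G i) :
    grCls i (x * y) (mul_mem hx hy) = grCls i x hx + grCls i y hy := rfl

lemma grCls_inv {i : ℕ} {x : G} (hx : x ∈ Gam G i) :
    grCls i x⁻¹ (inv_mem hx) = - grCls i x hx := rfl

lemma Gam_conj_mem {i : ℕ} (g : G) {x : G} (hx : x ∈ Gam G i) : g * x * g⁻¹ ∈ Gam G i :=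
  (inferInstance : (Gam G i).Normal).conj_mem x hx g

lemma grCls_conj {i : ℕ} (g : G) {x : G} (hx : x ∈ Gam G i) :
    grCls i (g * x * g⁻¹) (Gam_conj_mem g hx) = grCls i x hx := by
  symm
  rw [grCls_eq]
  have : x⁻¹ * (g * x * g⁻¹) = ⁅x⁻¹, g⁆ := by simp [commutatorElement_def, mul_assoc]
  rw [this]
  exact Subgroup.commutator_mem_commutator (inv_mem hx) (Subgroup.mem_top _)

lemma grCls_comm_mul_left {i j : ℕ} {x x' y : G} (hx : x ∈ Gam G i) (hx' : x' ∈ Gam G i)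
    (hy : y ∈ Gam G j) :
    grCls (i + j + 1) ⁅x * x', y⁆ (Gam_comm_mem j i (mul_mem hx hx') hy) =
      grCls (i + j + 1) ⁅x, y⁆ (Gam_comm_mem j i hx hy) +
      grCls (i + j + 1) ⁅x', y⁆ (Gam_comm_mem j i hx' hy) := by
  have h := Gam_comm_mem j i hx hy
  have h' := Gam_comm_mem j i hx' hy
  rw [add_comm (grCls _ _ h), ← grCls_conj x h', ← grCls_mul]
  congr 1
  exact commutatorElement_mul_left_eq_conj_mul _ _ _

lemma grCls_comm_mul_right {i j : ℕ} {x y y' : G} (hx : x ∈ Gam G i) (hy : y ∈ Gam G j)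
    (hy' : y' ∈ Gam G j) :
    grCls (i + j + 1) ⁅x, y * y'⁆ (Gam_comm_mem j i hx (mul_mem hy hy')) =
      grCls (i + j + 1) ⁅x, y⁆ (Gam_comm_mem j i hx hy) +
      grCls (i + j + 1) ⁅x, y'⁆ (Gam_comm_mem j i hx hy') := by
  have h := Gam_comm_mem j i hx hy
  have h' := Gam_comm_mem j i hx hy'
  rw [← grCls_conj y h', ← grCls_mul]
  congr 1
  rw [commutatorElement_mul_right_eq_mul_conj]; group

lemma grCls_eq_zero {i : ℕ} {x : G} {hx : x ∈ Gam G i} (h : x ∈ Gam G (i + 1)) :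
    grCls i x hx = 0 := by
  have : grCls i (1 : G) (one_mem _) = 0 := rfl
  rw [← this, grCls_eq]
  simpa using inv_mem h

/-- Bracketing with a fixed element of `Γ^{i+1}(G)`. -/
def grBracketAux (i j : ℕ) (x : Gam G i) : GrPiece G j →+ GrPiece G (i + j + 1) :=
  MonoidHom.toAdditive <| QuotientGroup.lift _
    { toFun := fun y : Gam G j =>
        (QuotientGroup.mk ⟨⁅(x : G), (y : G)⁆, Gam_comm_mem j i x.2 y.2⟩ : GrQuot G (i + j + 1))
      map_one' := by
        have := grCls_eq_zero (i := i + j + 1) (x := ⁅(x : G), (1 : G)⁆)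
          (hx := Gam_comm_mem j i x.2 (one_mem _)) (by simp)
        exact this
      map_mul' := fun y y' => grCls_comm_mul_right x.2 y.2 y'.2 }
    (fun y hy => grCls_eq_zero (i := i + j + 1) (x := ⁅(x : G), (y : G)⁆)
          (hx := Gam_comm_mem j i x.2 y.2)
          (Gam_comm_mem (j + 1) i x.2 (Subgroup.mem_subgroupOf.1 hy)))

/-- The bracket `gr_{i+1}(G) × gr_{j+1}(G) → gr_{i+j+2}(G)` induced by the commutator
`[x, y] = x y x⁻¹ y⁻¹`. -/
def grBracket (i j : ℕ) : GrPiece G i →+ GrPiece G j →+ GrPiece G (i + j + 1) :=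
  MonoidHom.toAdditiveLeft <| QuotientGroup.lift _
    { toFun := fun x : Gam G i => Multiplicative.ofAdd (grBracketAux i j x)
      map_one' := by
        apply Multiplicative.toAdd.injective
        refine AddMonoidHom.ext fun a => ?_
        obtain ⟨y, hy, rfl⟩ := grCls_surj a
        exact grCls_eq_zero (i := i + j + 1) (x := ⁅(1 : G), y⁆)
          (hx := Gam_comm_mem j i (one_mem _) hy) (by simp)
      map_mul' := fun x x' => by
        apply Multiplicative.toAdd.injective
        refine AddMonoidHom.ext fun a => ?_
        obtain ⟨y, hy, rfl⟩ := grCls_surj a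
        exact grCls_comm_mul_left x.2 x'.2 hy }
    (fun x hx => by
        apply Multiplicative.toAdd.injective
        refine AddMonoidHom.ext fun a => ?_
        obtain ⟨y, hy, rfl⟩ := grCls_surj a
        refine grCls_eq_zero (i := i + j + 1) (x := ⁅(x : G), y⁆)
          (hx := Gam_comm_mem j i x.2 hy) ?_
        have := Gam_comm_mem j (i + 1) (Subgroup.mem_subgroupOf.1 hx) hy
        rwa [show i + 1 + j + 1 = i + j + 1 + 1 by ring] at this)

lemma grBracket_cls {i j : ℕ} {x y : G} (hx : x ∈ Gam G i) (hy : y ∈ Gam G j) :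
    grBracket i j (grCls i x hx) (grCls j y hy) =
      grCls (i + j + 1) ⁅x, y⁆ (Gam_comm_mem j i hx hy) := rfl

/-- `gr_*(G) = ⨁_{i ≥ 1} Γ^i(G) / Γ^{i+1}(G)`. -/
abbrev Gr (G : Type*) [Group G] : Type _ := ⨁ i : ℕ, GrPiece G i

/-- The inclusion of the `i`-th summand. -/
def Gr.of (G : Type*) [Group G] (i : ℕ) : GrPiece G i →+ Gr G :=
  DirectSum.of (fun i => GrPiece G i) i

lemma Gr.addHom_ext {A : Type*} [AddMonoid A] {f g : Gr G →+ A}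
    (h : ∀ i x (hx : x ∈ Gam G i), f (Gr.of G i (grCls i x hx)) = g (Gr.of G i (grCls i x hx))) :
    f = g := by
  refine DirectSum.addHom_ext fun i y => ?_
  obtain ⟨x, hx, rfl⟩ := grCls_surj y
  exact h i x hx

/-- The bilinear bracket of `gr_*(G)`. -/
def Gr.bracketHom (G : Type*) [Group G] : Gr G →+ Gr G →+ Gr G :=
  DirectSum.toAddMonoid fun i => AddMonoidHom.flip <|
    DirectSum.toAddMonoid fun j =>
      AddMonoidHom.flip ((AddMonoidHom.compHom (Gr.of G (i + j + 1))).comp (grBracket i j))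

lemma Gr.bracketHom_of {i j : ℕ} (a : GrPiece G i) (b : GrPiece G j) :
    Gr.bracketHom G (Gr.of G i a) (Gr.of G j b) = Gr.of G (i + j + 1) (grBracket i j a b) := by
  simp [Gr.bracketHom, Gr.of]

lemma Gr.bracketHom_cls {i j : ℕ} {x y : G} (hx : x ∈ Gam G i) (hy : y ∈ Gam G j) :
    Gr.bracketHom G (Gr.of G i (grCls i x hx)) (Gr.of G j (grCls j y hy)) =
      Gr.of G (i + j + 1) (grCls (i + j + 1) ⁅x, y⁆ (Gam_comm_mem j i hx hy)) :=
  Gr.bracketHom_of _ _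

lemma Gr.of_congr {i j : ℕ} (h : i = j) {x y : G} (hxy : x = y) (hx : x ∈ Gam G i)
    (hy : y ∈ Gam G j) : Gr.of G i (grCls i x hx) = Gr.of G j (grCls j y hy) := by
  subst h; subst hxy; rfl

lemma Gr.induction {p : Gr G → Prop} (a : Gr G) (zero : p 0)
    (of : ∀ i x (hx : x ∈ Gam G i), p (Gr.of G i (grCls i x hx)))
    (add : ∀ a b, p a → p b → p (a + b)) : p a := by
  refine DirectSum.induction_on a zero (fun i y => ?_) add
  obtain ⟨x, hx, rfl⟩ := grCls_surj y
  exact of i x hx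

lemma Gr.bracketHom_skew (a b : Gr G) : Gr.bracketHom G a b = - Gr.bracketHom G b a := by
  induction a using Gr.induction with
  | zero => simp
  | add a a' h h' => simp only [map_add, AddMonoidHom.add_apply, h, h', neg_add]
  | of i x hx =>
  induction b using Gr.induction with
  | zero => simp
  | add a a' h h' => simp only [map_add, AddMonoidHom.add_apply, h, h', neg_add]
  | of j y hy =>
  rw [Gr.bracketHom_cls, Gr.bracketHom_cls, ← map_neg, ← grCls_inv]
  exact Gr.of_congr (by ring) (commutatorElement_inv _ _).symm _ _

lemma Gr.bracketHom_self (a : Gr G) : Gr.bracketHom G a a = 0 := by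
  induction a using Gr.induction with
  | zero => simp
  | of i x hx =>
    rw [Gr.bracketHom_cls, grCls_eq_zero (by simp), map_zero]
  | add a b ha hb =>
    rw [map_add, map_add, AddMonoidHom.add_apply, AddMonoidHom.add_apply, ha, hb,
      Gr.bracketHom_skew b a]
    simp

lemma Gr.bracketHom_jacobi (a b c : Gr G) :
    Gr.bracketHom G (Gr.bracketHom G a b) c + Gr.bracketHom G (Gr.bracketHom G b c) a +
      Gr.bracketHom G (Gr.bracketHom G c a) b = 0 := by
  induction a using Gr.induction with
  | zero => simp
  | add a a' h h' =>
    simp only [map_add, AddMonoidHom.add_apply] at h h' ⊢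
    refine Eq.trans ?_ ((congrArg₂ (· + ·) h h').trans (add_zero 0))
    abel
  | of i x hx =>
  induction b using Gr.induction with
  | zero => simp
  | add a a' h h' =>
    simp only [map_add, AddMonoidHom.add_apply] at h h' ⊢
    refine Eq.trans ?_ ((congrArg₂ (· + ·) h h').trans (add_zero 0))
    abel
  | of j y hy =>
  induction c using Gr.induction with
  | zero => simp
  | add a a' h h' =>
    simp only [map_add, AddMonoidHom.add_apply] at h h' ⊢
    refine Eq.trans ?_ ((congrArg₂ (· + ·) h h').trans (add_zero 0))
    abel
  | of k z hz =>
  rw [← grCls_conj y hz]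
  nth_rewrite 2 [← grCls_conj z hx]
  nth_rewrite 3 [← grCls_conj x hy]
  rw [grCls_conj y hz]
  nth_rewrite 1 [← grCls_conj y hz]
  rw [Gr.bracketHom_cls, Gr.bracketHom_cls, Gr.bracketHom_cls, Gr.bracketHom_cls,
    Gr.bracketHom_cls, Gr.bracketHom_cls]
  let N := i + j + 1 + k + 1
  have e1 : ⁅⁅x, y⁆, y * z * y⁻¹⁆ ∈ Gam G N :=
    Gam_comm_mem _ _ (Gam_comm_mem _ _ hx hy) (Gam_conj_mem y hz)
  have e2 : ⁅⁅y, z⁆, z * x * z⁻¹⁆ ∈ Gam G N := by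
    have := Gam_comm_mem _ _ (Gam_comm_mem _ _ hy hz) (Gam_conj_mem z hx)
    rwa [show j + k + 1 + i + 1 = N by simp only [N]; ring] at this
  have e3 : ⁅⁅z, x⁆, x * y * x⁻¹⁆ ∈ Gam G N := by
    have := Gam_comm_mem _ _ (Gam_comm_mem _ _ hz hx) (Gam_conj_mem x hy)
    rwa [show k + i + 1 + j + 1 = N by simp only [N]; ring] at this
  rw [Gr.of_congr (show _ = N from rfl) rfl _ e1,
    Gr.of_congr (show j + k + 1 + i + 1 = N by simp only [N]; ring) rfl _ e2,
    Gr.of_congr (show k + i + 1 + j + 1 = N by simp only [N]; ring) rfl _ e3,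
    ← map_add, ← map_add, ← grCls_mul, ← grCls_mul, grCls_eq_zero, map_zero]
  rw [commutatorElement_commutatorElement_conj_mul]
  exact one_mem _

/-- `gr_*(G)` is a Lie ring (a Lie algebra over `ℤ`) under the bracket induced by commutators. -/
instance Gr.lieRing : LieRing (Gr G) where
  bracket a b := Gr.bracketHom G a b
  add_lie a b c := by
    change Gr.bracketHom G (a + b) c = _
    rw [map_add]; rfl
  lie_add a b c := map_add _ _ _
  lie_self a := Gr.bracketHom_self a
  leibniz_lie a b c := by
    have h := Gr.bracketHom_jacobi a b c
    change Gr.bracketHom G a (Gr.bracketHom G b c) = Gr.bracketHom G (Gr.bracketHom G a b) c +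
      Gr.bracketHom G b (Gr.bracketHom G a c)
    rw [Gr.bracketHom_skew a (Gr.bracketHom G b c), Gr.bracketHom_skew b (Gr.bracketHom G a c),
      Gr.bracketHom_skew a c, map_neg, AddMonoidHom.neg_apply, neg_neg, neg_eq_iff_add_eq_zero,
      ← h]
    abel

lemma Gam_map (f : G →* H) {i : ℕ} {x : G} (hx : x ∈ Gam G i) : f x ∈ Gam H i :=
  by
  have h := Subgroup.mem_map_of_mem f hx
  rw [Subgroup.map_lowerCentralSeries] at h
  exact Subgroup.lowerCentralSeries_mono i le_top h

/-- The map `gr_{i+1}(G) → gr_{i+1}(H)` induced by a homomorphism `G → H`. -/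
def grPieceMap (f : G →* H) (i : ℕ) : GrPiece G i →+ GrPiece H i :=
  MonoidHom.toAdditive <| QuotientGroup.map _ _
    ((f.comp (Gam G i).subtype).codRestrict (Gam H i) fun x => Gam_map f x.2)
    fun _ hx => Subgroup.mem_comap.2 <| Subgroup.mem_subgroupOf.2 <|
      Gam_map f (Subgroup.mem_subgroupOf.1 hx)

lemma grPieceMap_cls (f : G →* H) {i : ℕ} {x : G} (hx : x ∈ Gam G i) :
    grPieceMap f i (grCls i x hx) = grCls i (f x) (Gam_map f hx) := rfl

/-- The underlying additive map of `Gr.map`. -/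
def Gr.mapAdd (f : G →* H) : Gr G →+ Gr H := DirectSum.map (grPieceMap f)

lemma Gr.mapAdd_cls (f : G →* H) {i : ℕ} {x : G} (hx : x ∈ Gam G i) :
    Gr.mapAdd f (Gr.of G i (grCls i x hx)) = Gr.of H i (grCls i (f x) (Gam_map f hx)) :=
  DirectSum.map_of _ _ _

/-- The morphism of Lie algebras `gr_*(f) : gr_*(G) → gr_*(H)` induced by a homomorphism
`f : G → H`. -/
def Gr.map (f : G →* H) : Gr G →ₗ⁅ℤ⁆ Gr H :=
  { (Gr.mapAdd f).toIntLinearMap with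
    map_lie' := by
      intro a b
      change Gr.mapAdd f (Gr.bracketHom G a b) =
        Gr.bracketHom H (Gr.mapAdd f a) (Gr.mapAdd f b)
      induction a using Gr.induction with
      | zero => simp
      | add a a' h h' => simp only [map_add, AddMonoidHom.add_apply, h, h']
      | of i x hx =>
      induction b using Gr.induction with
      | zero => simp
      | add a a' h h' => simp only [map_add, h, h']
      | of j y hy =>
      rw [Gr.bracketHom_cls, Gr.mapAdd_cls, Gr.mapAdd_cls, Gr.mapAdd_cls, Gr.bracketHom_cls]
      exact Gr.of_congr rfl (map_commutatorElement f x y) _ _ }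

lemma Gr.map_cls (f : G →* H) {i : ℕ} {x : G} (hx : x ∈ Gam G i) :
    Gr.map f (Gr.of G i (grCls i x hx)) = Gr.of H i (grCls i (f x) (Gam_map f hx)) :=
  Gr.mapAdd_cls f hx

lemma Gr.map_id : Gr.map (MonoidHom.id G) = LieHom.id := by
  refine LieHom.ext fun a => ?_
  induction a using Gr.induction with
  | zero => simp
  | add a a' h h' => simp only [map_add, h, h']
  | of i x hx => rw [Gr.map_cls]; rfl

lemma Gr.map_comp (g : H →* K) (f : G →* H) :
    Gr.map (g.comp f) = (Gr.map g).comp (Gr.map f) := by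
  refine LieHom.ext fun a => ?_
  induction a using Gr.induction with
  | zero => simp
  | add a a' h h' => simp only [map_add, h, h']
  | of i x hx => rw [LieHom.comp_apply, Gr.map_cls, Gr.map_cls, Gr.map_cls]; rfl

end GradedLie

section Braid

/-- The Artin relations for the braid group on `n` strands: `σ_i σ_j = σ_j σ_i` for `|i - j| ≥ 2`
and `σ_i σ_{i+1} σ_i = σ_{i+1} σ_i σ_{i+1}`. -/
inductive BraidRel (n : ℕ) : FreeGroup (Fin (n - 1)) → Prop
  | far (i j : Fin (n - 1)) (h : (i : ℕ) + 2 ≤ j) :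
      BraidRel n (FreeGroup.of i * FreeGroup.of j * (FreeGroup.of j * FreeGroup.of i)⁻¹)
  | braid (i j : Fin (n - 1)) (h : (i : ℕ) + 1 = j) :
      BraidRel n (FreeGroup.of i * FreeGroup.of j * FreeGroup.of i *
        (FreeGroup.of j * FreeGroup.of i * FreeGroup.of j)⁻¹)

/-- Artin's braid group `B_n` on `n` strands, with generators `σ_0, …, σ_{n-2}`. -/
abbrev BraidGroup (n : ℕ) : Type := PresentedGroup {r | BraidRel n r}

/-- The Artin generator `σ_i` of `B_n`, crossing the strands in positions `i` and `i + 1`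
(positions are numbered from `0`); by convention it is `1` when there are no such strands. -/
def braidGen (n i : ℕ) : BraidGroup n :=
  if h : i < n - 1 then PresentedGroup.of ⟨i, h⟩ else 1

lemma braidGen_eq {n : ℕ} (i : Fin (n - 1)) : PresentedGroup.of i = braidGen n i := by
  simp [braidGen]

lemma braidGen_comm {n i j : ℕ} (h : i + 2 ≤ j) :
    braidGen n i * braidGen n j = braidGen n j * braidGen n i := by
  unfold braidGen
  split_ifs with hi hj
  · have := PresentedGroup.one_of_mem (rels := {r | BraidRel n r}) (BraidRel.far ⟨i, hi⟩ ⟨j, hj⟩ h)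
    rw [map_mul, map_inv, mul_inv_eq_one, map_mul, map_mul] at this
    exact this
  all_goals simp

lemma braidGen_braid {n i : ℕ} (h : i + 2 < n) :
    braidGen n i * braidGen n (i + 1) * braidGen n i =
      braidGen n (i + 1) * braidGen n i * braidGen n (i + 1) := by
  unfold braidGen
  rw [dif_pos (by omega), dif_pos (by omega)]
  have := PresentedGroup.one_of_mem (rels := {r | BraidRel n r})
    (BraidRel.braid ⟨i, by omega⟩ ⟨i + 1, by omega⟩ rfl)
  rw [map_mul, map_inv, mul_inv_eq_one, map_mul, map_mul, map_mul, map_mul] at this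
  exact this

lemma BraidGroup.induction {n : ℕ} {p : BraidGroup n → Prop} (b : BraidGroup n) (one : p 1)
    (gen : ∀ i, i + 1 < n → p (braidGen n i)) (mul : ∀ a b, p a → p b → p (a * b))
    (inv : ∀ a, p a → p a⁻¹) : p b := by
  induction b using PresentedGroup.induction_on with | _ w => ?_
  induction w using FreeGroup.induction_on with
  | C1 => exact one
  | of i =>
    have := gen i (by have := i.2; omega)
    rwa [← braidGen_eq] at this
  | inv_of i h => exact inv _ h
  | mul a b ha hb => rw [map_mul]; exact mul _ _ ha hb

/-- The homomorphism out of `B_n` given by images of the `σ_i` that satisfy the Artin relations. -/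
def braidLift {n : ℕ} {K : Type*} [Group K] (s : ℕ → K)
    (far : ∀ i j, i + 2 ≤ j → j + 1 < n → s i * s j = s j * s i)
    (braid : ∀ i, i + 2 < n → s i * s (i + 1) * s i = s (i + 1) * s i * s (i + 1)) :
    BraidGroup n →* K :=
  PresentedGroup.toGroup (f := fun i : Fin (n - 1) => s i) (by
    rintro _ (⟨i, j, h⟩ | ⟨i, j, h⟩)
    · have := j.2
      rw [map_mul, map_inv, mul_inv_eq_one]
      simpa using far i j h (by omega)
    · have := j.2
      rw [map_mul, map_inv, mul_inv_eq_one]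
      simpa [← h] using braid i (by omega))

lemma braidLift_gen {n : ℕ} {K : Type*} [Group K] (s : ℕ → K) (far braid) {i : ℕ}
    (h : i + 1 < n) : braidLift (n := n) s far braid (braidGen n i) = s i := by
  have h' : i < n - 1 := by omega
  rw [braidGen, dif_pos h', braidLift, PresentedGroup.toGroup.of]

/-- The permutation of the positions of the strands underlying a braid; `σ_i` goes to the
transposition of `i` and `i + 1`. -/
def braidPerm (n : ℕ) : BraidGroup n →* Equiv.Perm ℕ :=
  braidLift (fun i => Equiv.swap i (i + 1))
    (fun i j h _ => by
      ext x
      simp only [Equiv.Perm.mul_apply, Equiv.swap_apply_def]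
      split_ifs <;> omega)
    (fun i _ => by
      ext x
      simp only [Equiv.Perm.mul_apply, Equiv.swap_apply_def]
      split_ifs <;> omega)

lemma braidPerm_gen {n k : ℕ} (h : k + 1 < n) :
    braidPerm n (braidGen n k) = Equiv.swap k (k + 1) := braidLift_gen _ _ _ h

/-- The pure braid group `P_n` on `n` strands. -/
abbrev PureBraid (n : ℕ) : Subgroup (BraidGroup n) := (braidPerm n).ker

/-! ### Block crossings -/

/-- The strand in position `a` crosses the next `q` strands. -/
def strandCross (m a : ℕ) : ℕ → BraidGroup m
  | 0 => 1
  | q + 1 => braidGen m (a + q) * strandCross m a q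

/-- The block of the `p` parallel strands in positions `a, …, a + p - 1` crosses the block of the
`q` parallel strands in positions `a + p, …, a + p + q - 1`. -/
def blockCross (m a : ℕ) : ℕ → ℕ → BraidGroup m
  | 0, _ => 1
  | p + 1, q => blockCross m a p q * strandCross m (a + p) q

variable {m : ℕ}

lemma strandCross_comm_gen_lt {a q j : ℕ} (h : j + 2 ≤ a) :
    Commute (braidGen m j) (strandCross m a q) := by
  induction q with
  | zero => exact Commute.one_right _
  | succ q ih =>
    have h' : Commute (braidGen m j) (braidGen m (a + q)) := braidGen_comm (by omega)
    exact h'.mul_right ih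

lemma strandCross_comm_gen_gt {a q j : ℕ} (h : a + q + 1 ≤ j) :
    Commute (braidGen m j) (strandCross m a q) := by
  induction q with
  | zero => exact Commute.one_right _
  | succ q ih =>
    have h' : Commute (braidGen m (a + q)) (braidGen m j) := braidGen_comm (by omega)
    exact h'.symm.mul_right (ih (by omega))

lemma strandCross_comm {a q b r : ℕ} (h : a + q < b) :
    Commute (strandCross m a q) (strandCross m b r) := by
  induction q with
  | zero => exact Commute.one_left _
  | succ q ih => exact (strandCross_comm_gen_lt (by omega)).mul_left (ih (by omega))

lemma blockCross_comm_strandCross {a p q b r : ℕ} (h : a + p + q ≤ b) :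
    Commute (blockCross m a p q) (strandCross m b r) := by
  induction p with
  | zero => exact Commute.one_left _
  | succ p ih => exact (ih (by omega)).mul_left (strandCross_comm (by omega))

lemma blockCross_comm {a p q b r s : ℕ} (h : a + p + q ≤ b) :
    Commute (blockCross m a p q) (blockCross m b r s) := by
  induction r with
  | zero => exact Commute.one_right _
  | succ r ih => exact ih.mul_right (blockCross_comm_strandCross (by omega))

lemma strandCross_add {a q q' : ℕ} :
    strandCross m a (q + q') = strandCross m (a + q) q' * strandCross m a q := by
  induction q' with
  | zero => simp [strandCross]
  | succ q' ih =>
    rw [← add_assoc, strandCross, ih, strandCross, mul_assoc, add_assoc]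

lemma blockCross_add_left {a p p' q : ℕ} :
    blockCross m a (p + p') q = blockCross m a p q * blockCross m (a + p) p' q := by
  induction p' with
  | zero => simp [blockCross]
  | succ p' ih =>
    rw [← add_assoc, blockCross, ih, blockCross, mul_assoc, add_assoc]

lemma blockCross_add_right {a p q q' : ℕ} :
    blockCross m a p (q + q') = blockCross m (a + q) p q' * blockCross m a p q := by
  induction p with
  | zero => simp [blockCross]
  | succ p ih =>
    have h : Commute (blockCross m a p q) (strandCross m (a + p + q) q') :=
      blockCross_comm_strandCross le_rfl
    rw [blockCross, ih, strandCross_add, blockCross, blockCross, mul_assoc,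
      ← mul_assoc (blockCross m a p q), h.eq, show a + q + p = a + p + q by ring]
    simp only [mul_assoc]

lemma strandCross_slide {a q j : ℕ} (h1 : a ≤ j) (h2 : j + 1 < a + q) (h3 : a + q < m) :
    braidGen m j * strandCross m a q = strandCross m a q * braidGen m (j + 1) := by
  induction q with
  | zero => omega
  | succ q ih =>
    by_cases h : j + 1 < a + q
    · rw [strandCross, ← mul_assoc, braidGen_comm (by omega), mul_assoc, ih h (by omega),
        mul_assoc]
    · obtain _ | q := q
      · omega
      obtain rfl : j = a + q := by omega
      have h4 : Commute (braidGen m (a + q + 1)) (strandCross m a q) :=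
        strandCross_comm_gen_gt le_rfl
      rw [strandCross, strandCross, ← add_assoc, mul_assoc, mul_assoc, ← h4.eq, ← mul_assoc,
        ← mul_assoc, braidGen_braid (by omega)]
      simp only [mul_assoc]

lemma blockCross_slide_gen {a p q j : ℕ} (h1 : a ≤ j) (h2 : j + 1 < a + q) (h3 : a + p + q ≤ m) :
    braidGen m j * blockCross m a p q = blockCross m a p q * braidGen m (j + p) := by
  induction p with
  | zero => simp [blockCross]
  | succ p ih =>
    rw [blockCross, ← mul_assoc, ih (by omega), mul_assoc,
      strandCross_slide (by omega) (by omega) (by omega), mul_assoc, add_assoc]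

lemma blockCross_slide_strand {a p q b r : ℕ} (h1 : a ≤ b) (h2 : b + r < a + q)
    (h3 : a + p + q ≤ m) :
    strandCross m b r * blockCross m a p q = blockCross m a p q * strandCross m (b + p) r := by
  induction r with
  | zero => simp [strandCross]
  | succ r ih =>
    rw [strandCross, mul_assoc, ih (by omega), ← mul_assoc,
      blockCross_slide_gen (by omega) (by omega) h3, strandCross, mul_assoc,
      show b + r + p = b + p + r by ring]

lemma blockCross_slide {a p q b r s : ℕ} (h1 : a ≤ b) (h2 : b + r + s ≤ a + q)
    (h3 : a + p + q ≤ m) :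
    blockCross m b r s * blockCross m a p q = blockCross m a p q * blockCross m (b + p) r s := by
  induction r with
  | zero => simp [blockCross]
  | succ r ih =>
    rw [blockCross, mul_assoc, blockCross_slide_strand (by omega) (by omega) h3, ← mul_assoc,
      ih (by omega), blockCross, mul_assoc, show b + r + p = b + p + r by ring]

lemma blockCross_braid {a p q r : ℕ} (h : a + p + q + r ≤ m) :
    blockCross m a q r * blockCross m (a + q) p r * blockCross m a p q =
      blockCross m (a + r) p q * blockCross m a p r * blockCross m (a + p) q r := by
  rw [mul_assoc, ← blockCross_add_right, ← blockCross_add_right,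
    blockCross_slide le_rfl (by omega) (by omega), add_comm r q]

/-! ### Multiplicities -/

/-- The number of strands that replace the first `k` strands. -/
def psum (c : ℕ → ℕ) (k : ℕ) : ℕ := ∑ i ∈ Finset.range k, c i

lemma psum_succ (c : ℕ → ℕ) (k : ℕ) : psum c (k + 1) = psum c k + c k :=
  Finset.sum_range_succ _ _

lemma psum_mono (c : ℕ → ℕ) {j k : ℕ} (h : j ≤ k) : psum c j ≤ psum c k :=
  Finset.sum_le_sum_of_subset (Finset.range_mono h)

lemma psum_congr {c d : ℕ → ℕ} {k : ℕ} (h : ∀ i < k, c i = d i) : psum c k = psum d k :=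
  Finset.sum_congr rfl fun i hi => h i (Finset.mem_range.1 hi)

/-- Exchange the multiplicities in positions `k` and `k + 1`. -/
def swapMult (k : ℕ) (c : ℕ → ℕ) : ℕ → ℕ := fun i => c (Equiv.swap k (k + 1) i)

lemma swapMult_left (k : ℕ) (c : ℕ → ℕ) : swapMult k c k = c (k + 1) := by simp [swapMult]

lemma swapMult_right (k : ℕ) (c : ℕ → ℕ) : swapMult k c (k + 1) = c k := by simp [swapMult]

lemma swapMult_of_ne {k i : ℕ} (c : ℕ → ℕ) (h : i ≠ k) (h' : i ≠ k + 1) :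
    swapMult k c i = c i := by simp [swapMult, Equiv.swap_apply_of_ne_of_ne h h']

lemma swapMult_swapMult (k : ℕ) (c : ℕ → ℕ) : swapMult k (swapMult k c) = c := by
  ext i; simp [swapMult]

lemma psum_swapMult {k j : ℕ} (c : ℕ → ℕ) (h : j ≠ k + 1) : psum (swapMult k c) j = psum c j := by
  rcases lt_or_gt_of_ne h with h | h
  · exact psum_congr fun i hi => swapMult_of_ne c (by omega) (by omega)
  · obtain ⟨d, rfl⟩ := Nat.exists_eq_add_of_lt h
    induction d with
    | zero =>
      rw [show k + 1 + 0 + 1 = k + 1 + 1 by ring, psum_succ, psum_succ, psum_succ, psum_succ,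
        swapMult_left, swapMult_right,
        psum_congr (d := c) fun i hi => swapMult_of_ne c (by omega) (by omega)]
      ring
    | succ d ih =>
      rw [← add_assoc, psum_succ, ih (by omega) (by omega), psum_succ _ (_ + 1),
        swapMult_of_ne c (by omega) (by omega)]

/-- The ways of replacing `n` strands by parallel strands, `m` in all: the strand in position `k`
is replaced by `c k` parallel strands. Only the values `c k` for `k < n` matter. -/
abbrev Mult (m n : ℕ) : Type := {c : ℕ → ℕ // psum c n = m}

/-- The cabling action of `σ_k`: the block that replaces the strand `k` crosses the block
that replaces the strand `k + 1`, and the multiplicities are exchanged. -/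
def cableGen (m n k : ℕ) : Equiv.Perm (Mult m n × BraidGroup m) where
  toFun x := if h : k + 1 < n then
      (⟨swapMult k x.1.1, by rw [psum_swapMult _ (by omega)]; exact x.1.2⟩,
        blockCross m (psum x.1.1 k) (x.1.1 k) (x.1.1 (k + 1)) * x.2) else x
  invFun x := if h : k + 1 < n then
      (⟨swapMult k x.1.1, by rw [psum_swapMult _ (by omega)]; exact x.1.2⟩,
        (blockCross m (psum x.1.1 k) (x.1.1 (k + 1)) (x.1.1 k))⁻¹ * x.2) else x
  left_inv x := by
    by_cases h : k + 1 < n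
    · simp only [h, dite_true]
      refine Prod.ext (Subtype.ext (swapMult_swapMult _ _)) ?_
      simp [swapMult_left, swapMult_right, psum_swapMult]
    · simp [h]
  right_inv x := by
    by_cases h : k + 1 < n
    · simp only [h, dite_true]
      refine Prod.ext (Subtype.ext (swapMult_swapMult _ _)) ?_
      simp [swapMult_left, swapMult_right, psum_swapMult]
    · simp [h]

lemma cableGen_apply {m n k : ℕ} (h : k + 1 < n) (x : Mult m n × BraidGroup m) :
    cableGen m n k x =
      (⟨swapMult k x.1.1, by rw [psum_swapMult _ (by omega)]; exact x.1.2⟩,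
        blockCross m (psum x.1.1 k) (x.1.1 k) (x.1.1 (k + 1)) * x.2) := dif_pos h

/-- The cabling action of `B_n`. If `b` carries `(c, 1)` to `(c', w)`, then `w` is the braid
obtained from `b` by replacing the strand that starts in position `k` by `c k` parallel strands,
for all `k`, and `c'` lists the multiplicities at the other end. -/
def cableAct (m n : ℕ) : BraidGroup n →* Equiv.Perm (Mult m n × BraidGroup m) :=
  braidLift (cableGen m n)
    (fun i j hij hj => by
      refine Equiv.ext fun x => ?_
      simp only [Equiv.Perm.mul_apply, cableGen_apply hj,
        cableGen_apply (show i + 1 < n by omega)]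
      refine Prod.ext (Subtype.ext ?_) ?_
      · funext t
        simp only [swapMult, Equiv.swap_apply_def]
        split_ifs <;> first | rfl | omega
      · dsimp only
        rw [psum_swapMult _ (by omega), psum_swapMult _ (by omega),
          swapMult_of_ne _ (by omega) (by omega), swapMult_of_ne _ (by omega) (by omega),
          swapMult_of_ne _ (by omega) (by omega), swapMult_of_ne _ (by omega) (by omega),
          ← mul_assoc, ← mul_assoc, (blockCross_comm (m := m) ?_ : Commute _ _).eq]
        rw [← psum_succ, ← psum_succ]
        exact psum_mono _ hij)
    (fun i hi => by
      refine Equiv.ext fun x => ?_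
      simp only [Equiv.Perm.mul_apply, cableGen_apply (show i + 1 + 1 < n by omega),
        cableGen_apply (show i + 1 < n by omega)]
      refine Prod.ext (Subtype.ext ?_) ?_
      · funext t
        simp only [swapMult, Equiv.swap_apply_def]
        split_ifs <;> first | rfl | omega
      · obtain ⟨⟨c, hc⟩, g⟩ := x
        have h3 : psum c (i + 3) ≤ m := by rw [← hc]; exact psum_mono _ (by omega)
        rw [psum_succ, psum_succ, psum_succ] at h3
        have e1 : swapMult i c (i + 1 + 1) = c (i + 2) :=
          swapMult_of_ne _ (by omega) (by omega)
        have e2 : swapMult (i + 1) c i = c i := swapMult_of_ne _ (by omega) (by omega)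
        have e3 : swapMult (i + 1) (swapMult i c) i = c (i + 1) := by
          rw [swapMult_of_ne _ (by omega) (by omega), swapMult_left]
        have e4 : swapMult i (swapMult (i + 1) c) (i + 1 + 1) = c (i + 1) := by
          rw [swapMult_of_ne _ (by omega) (by omega), swapMult_right]
        dsimp only
        simp only [e3, e4, e1, e2, psum_succ, swapMult_left, swapMult_right,
          psum_swapMult _ (show i ≠ i + 1 by omega), psum_swapMult _ (show i ≠ i + 1 + 1 by omega)]
        rw [← mul_assoc, ← mul_assoc, ← mul_assoc, ← mul_assoc]
        rw [show i + 1 + 1 = i + 2 by ring]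
        rw [blockCross_braid (by omega)])

variable {l n : ℕ}

/-- The multiplicities at the other end of the braid. -/
def Mult.act (b : BraidGroup n) (c : Mult m n) : Mult m n := (cableAct m n b (c, 1)).1

/-- The cabled braid: the strand of `b` that starts in position `k` is replaced by `c k` parallel
strands. -/
def cable (c : Mult m n) (b : BraidGroup n) : BraidGroup m := (cableAct m n b (c, 1)).2

lemma cableAct_apply (b : BraidGroup n) (x : Mult m n × BraidGroup m) :
    cableAct m n b x = (Mult.act b x.1, cable x.1 b * x.2) := by
  have key : ∀ (x : Mult m n × BraidGroup m) (g : BraidGroup m),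
      cableAct m n b (x.1, x.2 * g) = ((cableAct m n b x).1, (cableAct m n b x).2 * g) := by
    induction b using BraidGroup.induction with
    | one => intro x g; simp
    | gen i hi =>
      intro x g
      rw [cableAct, braidLift_gen _ _ _ hi, cableGen_apply hi, cableGen_apply hi]
      simp [mul_assoc]
    | mul a b ha hb =>
      intro x g
      rw [map_mul, Equiv.Perm.mul_apply, hb, ha, Equiv.Perm.mul_apply]
    | inv a ha =>
      intro x g
      rw [map_inv, Equiv.Perm.inv_eq_iff_eq, ha]
      simp
  have := key (x.1, 1) x.2
  rw [one_mul] at this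
  exact this

lemma Mult.act_one (c : Mult m n) : Mult.act 1 c = c := by simp [Mult.act]

lemma cable_one (c : Mult m n) : cable c 1 = 1 := by simp [cable]

lemma Mult.act_mul (a b : BraidGroup n) (c : Mult m n) :
    Mult.act (a * b) c = Mult.act a (Mult.act b c) := by
  rw [Mult.act, map_mul, Equiv.Perm.mul_apply, cableAct_apply b, cableAct_apply]

lemma cable_mul (c : Mult m n) (a b : BraidGroup n) :
    cable c (a * b) = cable (Mult.act b c) a * cable c b := by
  rw [cable, map_mul, Equiv.Perm.mul_apply, cableAct_apply b, cableAct_apply, mul_one]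

lemma Mult.act_inv_act (b : BraidGroup n) (c : Mult m n) : Mult.act b⁻¹ (Mult.act b c) = c := by
  rw [← Mult.act_mul, inv_mul_cancel, Mult.act_one]

lemma Mult.act_act_inv (b : BraidGroup n) (c : Mult m n) : Mult.act b (Mult.act b⁻¹ c) = c := by
  rw [← Mult.act_mul, mul_inv_cancel, Mult.act_one]

lemma cable_inv (c : Mult m n) (b : BraidGroup n) :
    cable (Mult.act b c) b⁻¹ = (cable c b)⁻¹ := by
  rw [eq_inv_iff_mul_eq_one, ← cable_mul, inv_mul_cancel, cable_one]

lemma Mult.act_gen {k : ℕ} (h : k + 1 < n) (c : Mult m n) :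
    (Mult.act (braidGen n k) c).1 = swapMult k c.1 := by
  rw [Mult.act, cableAct, braidLift_gen _ _ _ h, cableGen_apply h]

lemma cable_gen {k : ℕ} (h : k + 1 < n) (c : Mult m n) :
    cable c (braidGen n k) = blockCross m (psum c.1 k) (c.1 k) (c.1 (k + 1)) := by
  rw [cable, cableAct, braidLift_gen _ _ _ h, cableGen_apply h, mul_one]

lemma Mult.act_val (b : BraidGroup n) (c : Mult m n) (i : ℕ) :
    (Mult.act b c).1 i = c.1 ((braidPerm n b)⁻¹ i) := by
  induction b using BraidGroup.induction generalizing c i with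
  | one => simp [Mult.act_one]
  | gen k h =>
    rw [Mult.act_gen h, braidPerm, braidLift_gen _ _ _ h, Equiv.swap_inv]; rfl
  | mul a b ha hb =>
    rw [Mult.act_mul, ha, hb, map_mul, mul_inv_rev, Equiv.Perm.mul_apply]
  | inv a ha =>
    have h := ha (Mult.act a⁻¹ c) ((braidPerm n a) i)
    rw [Mult.act_act_inv, ← Equiv.Perm.mul_apply, inv_mul_cancel, Equiv.Perm.one_apply] at h
    rw [← h, map_inv, inv_inv]

lemma Mult.act_pure {b : BraidGroup n} (hb : b ∈ PureBraid n) (c : Mult m n) :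
    Mult.act b c = c := by
  refine Subtype.ext (funext fun i => ?_)
  rw [Mult.act_val, MonoidHom.mem_ker.1 hb]; rfl

/-! ### Iterated cabling -/

/-- The number of strands that replace the `p` strands starting in position `a`. -/
def bsum (d : ℕ → ℕ) (a p : ℕ) : ℕ := ∑ i ∈ Finset.range p, d (a + i)

lemma bsum_succ (d : ℕ → ℕ) (a p : ℕ) : bsum d a (p + 1) = bsum d a p + d (a + p) :=
  Finset.sum_range_succ _ _

lemma bsum_congr {c d : ℕ → ℕ} {a b p : ℕ} (h : ∀ i < p, c (a + i) = d (b + i)) :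
    bsum c a p = bsum d b p :=
  Finset.sum_congr rfl fun i hi => h i (Finset.mem_range.1 hi)

lemma psum_add (d : ℕ → ℕ) (a p : ℕ) : psum d (a + p) = psum d a + bsum d a p :=
  Finset.sum_range_add _ _ _

/-- Exchange the adjacent blocks of lengths `p` and `q` starting in position `a`. -/
def blockSwap (a p q : ℕ) {α : Type*} (d : ℕ → α) : ℕ → α := fun i =>
  if i < a then d i else if i < a + q then d (i + p) else if i < a + q + p then d (i - q) else d i

lemma act_strandCross {a q : ℕ} (h : a + q < m) (d : Mult l m) :
    (Mult.act (strandCross m a q) d).1 = blockSwap a 1 q d.1 ∧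
    cable d (strandCross m a q) =
      blockCross l (psum d.1 a) (d.1 a) (bsum d.1 (a + 1) q) := by
  induction q with
  | zero =>
    have h0 : ∀ p, blockCross l (psum d.1 a) p 0 = 1 := by
      intro p
      induction p with
      | zero => rfl
      | succ p ih => rw [blockCross, ih, strandCross, one_mul]
    constructor
    · rw [strandCross, Mult.act_one]
      funext i
      simp only [blockSwap]
      split_ifs <;> first | rfl | exact congrArg d.1 (by omega)
    · rw [strandCross, cable_one, bsum, Finset.sum_range_zero, h0]
  | succ q ih =>
    obtain ⟨ih1, ih2⟩ := ih (by omega)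
    constructor
    · rw [strandCross, Mult.act_mul, Mult.act_gen (by omega), ih1]
      funext i
      simp only [swapMult, blockSwap, Equiv.swap_apply_def]
      split_ifs <;> first | rfl | exact congrArg d.1 (by omega)
    · rw [strandCross, cable_mul, cable_gen (by omega), ih1, ih2, bsum_succ, blockCross_add_right]
      congr 2
      · rw [psum_add, psum_congr (d := d.1), bsum_congr (d := d.1) (b := a + 1)]
        · intro i hi
          simp only [blockSwap]
          split_ifs <;> first | rfl | exact congrArg d.1 (by omega)
        · intro i hi
          simp only [blockSwap]
          split_ifs; rfl
      · simp only [blockSwap]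
        split_ifs <;> first | rfl | exact congrArg d.1 (by omega)
      · simp only [blockSwap]
        split_ifs <;> first | rfl | exact congrArg d.1 (by omega)

lemma act_blockCross {a p q : ℕ} (h : a + p + q ≤ m) (d : Mult l m) :
    (Mult.act (blockCross m a p q) d).1 = blockSwap a p q d.1 ∧
    cable d (blockCross m a p q) =
      blockCross l (psum d.1 a) (bsum d.1 a p) (bsum d.1 (a + p) q) := by
  induction p generalizing d with
  | zero =>
    constructor
    · rw [blockCross, Mult.act_one]
      funext i
      simp only [blockSwap]
      split_ifs <;> first | rfl | exact congrArg d.1 (by omega)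
    · rw [blockCross, cable_one]; rfl
  | succ p ih =>
    obtain ⟨s1, s2⟩ := act_strandCross (l := l) (m := m) (a := a + p) (q := q) (by omega) d
    obtain ⟨ih1, ih2⟩ := ih (by omega) (Mult.act (strandCross m (a + p) q) d)
    constructor
    · rw [blockCross, Mult.act_mul, ih1, s1]
      funext i
      simp only [blockSwap]
      split_ifs <;> first | rfl | exact congrArg d.1 (by omega)
    · rw [blockCross, cable_mul, ih2, s1, s2, bsum_succ, blockCross_add_left, psum_add]
      congr 2
      · refine psum_congr fun i hi => ?_
        simp only [blockSwap]
        split_ifs <;> first | rfl | exact congrArg d.1 (by omega)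
      · refine bsum_congr fun i hi => ?_
        simp only [blockSwap]
        split_ifs <;> first | rfl | exact congrArg d.1 (by omega)
      · refine bsum_congr fun i hi => ?_
        simp only [blockSwap]
        split_ifs <;> first | rfl | exact congrArg d.1 (by omega)

/-- Composite multiplicities: strands are first replaced according to `c`, the new strands then
according to `d`. -/
def Mult.comp (d : Mult l m) (c : Mult m n) : Mult l n :=
  ⟨fun k => bsum d.1 (psum c.1 k) (c.1 k), by
    have key : ∀ k, psum (fun k => bsum d.1 (psum c.1 k) (c.1 k)) k = psum d.1 (psum c.1 k) := by
      intro k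
      induction k with
      | zero => rfl
      | succ k ih => rw [psum_succ, ih, psum_succ, psum_add]
    rw [key, c.2, d.2]⟩

lemma Mult.psum_comp (d : Mult l m) (c : Mult m n) (k : ℕ) :
    psum (d.comp c).1 k = psum d.1 (psum c.1 k) := by
  induction k with
  | zero => rfl
  | succ k ih => rw [psum_succ, ih, psum_succ, psum_add]; rfl

lemma cable_comp (b : BraidGroup n) (c : Mult m n) (d : Mult l m) :
    Mult.act b (d.comp c) = (Mult.act (cable c b) d).comp (Mult.act b c) ∧
    cable (d.comp c) b = cable d (cable c b) := by
  induction b using BraidGroup.induction generalizing c d with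
  | one => simp [cable_one, Mult.act_one]
  | gen k hk =>
    have hm : psum c.1 k + c.1 k + c.1 (k + 1) ≤ m := by
      have : psum c.1 (k + 2) ≤ m := by
        have := psum_mono c.1 (show k + 2 ≤ n by omega)
        rwa [c.2] at this
      rwa [psum_succ, psum_succ] at this
    obtain ⟨h1, h2⟩ := act_blockCross (l := l) hm d
    rw [cable_gen hk, h2, cable_gen hk, Mult.psum_comp]
    refine ⟨Subtype.ext (funext fun j => ?_), ?_⟩
    · rw [Mult.act_gen hk]
      change _ = bsum _ _ _
      rw [h1, Mult.act_gen hk]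
      by_cases j1 : j = k
      · subst j1
        rw [swapMult_left, swapMult_left, psum_swapMult _ (by omega)]
        refine bsum_congr fun i hi => ?_
        rw [psum_succ]
        simp only [blockSwap]
        split_ifs <;> first | rfl | exact congrArg d.1 (by omega)
      by_cases j2 : j = k + 1
      · subst j2
        rw [swapMult_right, swapMult_right, psum_succ, swapMult_left, psum_swapMult _ (by omega)]
        refine bsum_congr fun i hi => ?_
        simp only [blockSwap]
        split_ifs <;> first | rfl | exact congrArg d.1 (by omega)
      rw [swapMult_of_ne _ j1 j2, swapMult_of_ne _ j1 j2, psum_swapMult _ j2]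
      refine bsum_congr fun i hi => ?_
      simp only [blockSwap]
      by_cases j3 : j < k
      · have := psum_mono c.1 (show j + 1 ≤ k by omega)
        rw [psum_succ] at this
        rw [if_pos (by omega)]
      · have := psum_mono c.1 (show k + 2 ≤ j by omega)
        rw [psum_succ, psum_succ] at this
        rw [if_neg (by omega), if_neg (by omega), if_neg (by omega)]
    · rw [← psum_succ]; rfl
  | mul a b ha hb =>
    constructor
    · rw [Mult.act_mul, (hb c d).1, (ha _ _).1, cable_mul, Mult.act_mul, Mult.act_mul]
    · rw [cable_mul, (hb c d).1, (hb c d).2, (ha _ _).2, cable_mul, cable_mul]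
  | inv b hb =>
    obtain ⟨c, rfl⟩ : ∃ c', c = Mult.act b c' := ⟨_, (Mult.act_act_inv b c).symm⟩
    obtain ⟨d, rfl⟩ : ∃ d', d = Mult.act (cable c b) d' := ⟨_, (Mult.act_act_inv _ d).symm⟩
    rw [← (hb c d).1, cable_inv, cable_inv, Mult.act_inv_act, Mult.act_inv_act, Mult.act_inv_act,
      cable_inv, (hb c d).2]
    exact ⟨rfl, rfl⟩

/-! ### Cabling pure braids -/

lemma braidPerm_of_le (b : BraidGroup n) {i : ℕ} (h : n ≤ i) : braidPerm n b i = i := by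
  induction b using BraidGroup.induction with
  | one => simp
  | gen k hk =>
    rw [braidPerm, braidLift_gen _ _ _ hk, Equiv.swap_apply_of_ne_of_ne] <;> omega
  | mul a b ha hb => rw [map_mul, Equiv.Perm.mul_apply, hb, ha]
  | inv a ha => rw [map_inv, Equiv.Perm.inv_eq_iff_eq, ha]

lemma braidPerm_blockCross {a p q : ℕ} (h : a + p + q ≤ m) (f : ℕ → ℕ) (i : ℕ) :
    f ((braidPerm m (blockCross m a p q))⁻¹ i) = blockSwap a p q f i := by
  have := (act_blockCross h (⟨f, rfl⟩ : Mult (psum f m) m)).1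
  rw [← this, Mult.act_val]

lemma braidPerm_cable (b : BraidGroup n) (c : Mult m n) (u : ℕ → ℕ → ℕ) (f : ℕ → ℕ) :
    (∀ k < n, ∀ i < c.1 k, f (psum c.1 k + i) = u k i) ↔
    (∀ k < n, ∀ i < (Mult.act b c).1 k,
      f ((braidPerm m (cable c b))⁻¹ (psum (Mult.act b c).1 k + i)) =
        u ((braidPerm n b)⁻¹ k) i) := by
  induction b using BraidGroup.induction generalizing c u f with
  | one => simp [cable_one, Mult.act_one]
  | gen k hk =>
    have hm : psum c.1 k + c.1 k + c.1 (k + 1) ≤ m := by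
      have : psum c.1 (k + 2) ≤ m := by
        have := psum_mono c.1 (show k + 2 ≤ n by omega)
        rwa [c.2] at this
      rwa [psum_succ, psum_succ] at this
    rw [cable_gen hk, braidPerm_gen hk, Equiv.swap_inv, Mult.act_gen hk]
    simp only [braidPerm_blockCross hm]
    have hl : (∀ i < c.1 k, f (psum c.1 k + i) = u k i) ↔
        ∀ i < swapMult k c.1 (k + 1),
          blockSwap (psum c.1 k) (c.1 k) (c.1 (k + 1)) f (psum (swapMult k c.1) (k + 1) + i) =
            u (Equiv.swap k (k + 1) (k + 1)) i := by
      rw [swapMult_right, psum_succ, swapMult_left, psum_swapMult _ (by omega),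
        Equiv.swap_apply_right]
      refine forall₂_congr fun i hi => ?_
      simp only [blockSwap]
      rw [if_neg (by omega), if_neg (by omega), if_pos (by omega)]
      rw [show psum c.1 k + c.1 (k + 1) + i - c.1 (k + 1) = psum c.1 k + i by omega]
    have hr : (∀ i < c.1 (k + 1), f (psum c.1 (k + 1) + i) = u (k + 1) i) ↔
        ∀ i < swapMult k c.1 k,
          blockSwap (psum c.1 k) (c.1 k) (c.1 (k + 1)) f (psum (swapMult k c.1) k + i) =
            u (Equiv.swap k (k + 1) k) i := by
      rw [swapMult_left, psum_succ, psum_swapMult _ (by omega), Equiv.swap_apply_left]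
      refine forall₂_congr fun i hi => ?_
      simp only [blockSwap]
      rw [if_neg (by omega), if_pos (by omega)]
      rw [show psum c.1 k + i + c.1 k = psum c.1 k + c.1 k + i by omega]
    have ho : ∀ j, j ≠ k → j ≠ k + 1 → ((∀ i < c.1 j, f (psum c.1 j + i) = u j i) ↔
        ∀ i < swapMult k c.1 j,
          blockSwap (psum c.1 k) (c.1 k) (c.1 (k + 1)) f (psum (swapMult k c.1) j + i) =
            u (Equiv.swap k (k + 1) j) i) := by
      intro j j1 j2
      rw [swapMult_of_ne _ j1 j2, psum_swapMult _ j2, Equiv.swap_apply_of_ne_of_ne j1 j2]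
      refine forall₂_congr fun i hi => ?_
      simp only [blockSwap]
      by_cases j3 : j < k
      · have := psum_mono c.1 (show j + 1 ≤ k by omega)
        rw [psum_succ] at this
        rw [if_pos (by omega)]
      · have := psum_mono c.1 (show k + 2 ≤ j by omega)
        rw [psum_succ, psum_succ] at this
        rw [if_neg (by omega), if_neg (by omega), if_neg (by omega)]
    constructor
    · intro H j hj
      by_cases j1 : j = k
      · subst j1; exact hr.1 (H _ hk)
      by_cases j2 : j = k + 1
      · subst j2; exact hl.1 (H _ (by omega))
      exact (ho j j1 j2).1 (H j hj)
    · intro H j hj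
      by_cases j1 : j = k
      · subst j1; exact hl.2 (H _ hk)
      by_cases j2 : j = k + 1
      · subst j2; exact hr.2 (H _ (by omega))
      exact (ho j j1 j2).2 (H j hj)
  | mul a b ha hb =>
    rw [hb c u f, ha (Mult.act b c) (fun k => u ((braidPerm n b)⁻¹ k))
      (fun t => f ((braidPerm m (cable c b))⁻¹ t)), cable_mul, Mult.act_mul]
    simp only [map_mul, mul_inv_rev, Equiv.Perm.mul_apply]
  | inv b hb =>
    obtain ⟨c, rfl⟩ : ∃ c', c = Mult.act b c' := ⟨_, (Mult.act_act_inv b c).symm⟩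
    have h := hb c (fun k => u (braidPerm n b k)) (fun t => f (braidPerm m (cable c b) t))
    simp only [← Equiv.Perm.mul_apply, mul_inv_cancel, Equiv.Perm.one_apply] at h
    rw [← h, Mult.act_inv_act, cable_inv, map_inv, inv_inv, map_inv, inv_inv]

lemma exists_psum_add {c : ℕ → ℕ} {n t : ℕ} (h : t < psum c n) :
    ∃ k < n, ∃ i < c k, t = psum c k + i := by
  induction n with
  | zero => simp [psum] at h
  | succ n ih =>
    by_cases h' : t < psum c n
    · obtain ⟨k, hk, i, hi, e⟩ := ih h'
      exact ⟨k, by omega, i, hi, e⟩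
    · rw [psum_succ] at h
      exact ⟨n, by omega, t - psum c n, by omega, by omega⟩

lemma cable_mem (c : Mult m n) {b : BraidGroup n} (hb : b ∈ PureBraid n) :
    cable c b ∈ PureBraid m := by
  rw [MonoidHom.mem_ker]
  have h := (braidPerm_cable b c (fun k i => psum c.1 k + i) id).1 (fun _ _ _ _ => rfl)
  rw [Mult.act_pure hb, MonoidHom.mem_ker.1 hb] at h
  rw [← inv_eq_one]
  refine Equiv.ext fun t => ?_
  by_cases ht : t < m
  · rw [← c.2] at ht
    obtain ⟨k, hk, i, hi, rfl⟩ := exists_psum_add ht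
    exact h k hk i hi
  · rw [← map_inv]; exact braidPerm_of_le _ (by omega)

/-- Cabling of pure braids, `P_n → P_m`: the strand in position `k` is replaced by `c k` parallel
strands. -/
def pureCable (c : Mult m n) : PureBraid n →* PureBraid m where
  toFun b := ⟨cable c b.1, cable_mem c b.2⟩
  map_one' := Subtype.ext (cable_one c)
  map_mul' a b := Subtype.ext <| by
    change cable c (a.1 * b.1) = cable c a.1 * cable c b.1
    rw [cable_mul, Mult.act_pure b.2]

lemma pureCable_comp (d : Mult l m) (c : Mult m n) :
    pureCable (d.comp c) = (pureCable d).comp (pureCable c) := by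
  ext b
  exact (cable_comp b.1 c d).2

/-- The multiplicities given by the sizes of the fibres of a monotone map. -/
def fibreMult (f : Fin m →o Fin n) : Mult m n :=
  ⟨fun k => (Finset.univ.filter fun j => (f j : ℕ) = k).card, by
    rw [psum, ← Finset.card_eq_sum_card_fiberwise (s := Finset.univ) (f := fun j => (f j : ℕ))]
    · simp
    · intro j _; simp⟩

lemma psum_fibreMult (f : Fin m →o Fin n) (k : ℕ) :
    psum (fibreMult f).1 k = (Finset.univ.filter fun j => (f j : ℕ) < k).card := by
  rw [psum, Finset.card_eq_sum_card_fiberwise (f := fun j => (f j : ℕ)) (t := Finset.range k)]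
  · refine Finset.sum_congr rfl fun i hi => ?_
    rw [Finset.filter_filter]
    change (Finset.univ.filter fun j => (f j : ℕ) = i).card = _
    congr 1
    ext j
    have := Finset.mem_range.1 hi
    simp only [Finset.mem_filter, Finset.mem_univ, true_and]
    omega
  · intro j hj
    simpa using hj

lemma lt_psum_fibreMult (f : Fin m →o Fin n) (k : ℕ) (t : Fin m) :
    (t : ℕ) < psum (fibreMult f).1 k ↔ (f t : ℕ) < k := by
  rw [psum_fibreMult]
  constructor
  · intro h
    by_contra h'
    have : (Finset.univ.filter fun j => (f j : ℕ) < k) ⊆ Finset.Iio t := by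
      intro j hj
      rw [Finset.mem_Iio]
      by_contra h2
      have := f.monotone (not_lt.1 h2)
      simp only [Finset.mem_filter, Finset.mem_univ, true_and] at hj
      have := Fin.le_def.1 this
      omega
    have := Finset.card_le_card this
    rw [Fin.card_Iio] at this
    omega
  · intro h
    have : Finset.Iic t ⊆ (Finset.univ.filter fun j => (f j : ℕ) < k) := by
      intro j hj
      have := Fin.le_def.1 (f.monotone (Finset.mem_Iic.1 hj))
      simp only [Finset.mem_filter, Finset.mem_univ, true_and]
      omega
    have := Finset.card_le_card this
    rw [Fin.card_Iic] at this
    omega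

lemma Mult.ext_psum {c d : Mult m n} (h : ∀ k, psum c.1 k = psum d.1 k) : c = d := by
  refine Subtype.ext (funext fun k => ?_)
  have h1 := h (k + 1)
  rw [psum_succ, psum_succ, h k] at h1
  omega

lemma fibreMult_comp (f : Fin m →o Fin n) (h : Fin l →o Fin m) :
    fibreMult (f.comp h) = (fibreMult h).comp (fibreMult f) := by
  refine Mult.ext_psum fun k => ?_
  rw [Mult.psum_comp, psum_fibreMult, psum_fibreMult]
  congr 1
  ext j
  simp only [Finset.mem_filter, Finset.mem_univ, true_and]
  rw [lt_psum_fibreMult]; rfl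

lemma cable_fibreMult_id (b : BraidGroup n) :
    Mult.act b (fibreMult OrderHom.id) = fibreMult OrderHom.id ∧
      cable (fibreMult OrderHom.id) b = b := by
  have val : ∀ k < n, (fibreMult (OrderHom.id : Fin n →o Fin n)).1 k = 1 := by
    intro k hk
    change (Finset.univ.filter fun j : Fin n => (j : ℕ) = k).card = 1
    rw [Finset.card_eq_one]
    refine ⟨⟨k, hk⟩, ?_⟩
    ext j
    simp [Fin.ext_iff]
  have hp : ∀ k ≤ n, psum (fibreMult (OrderHom.id : Fin n →o Fin n)).1 k = k := by
    intro k hk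
    rw [psum, Finset.sum_congr rfl fun i hi =>
      val i (lt_of_lt_of_le (Finset.mem_range.1 hi) hk)]
    simp
  induction b using BraidGroup.induction with
  | one => exact ⟨Mult.act_one _, cable_one _⟩
  | gen k hk =>
    constructor
    · refine Subtype.ext (funext fun i => ?_)
      rw [Mult.act_gen hk]
      by_cases h1 : i = k
      · subst h1; rw [swapMult_left, val _ hk, val _ (by omega)]
      by_cases h2 : i = k + 1
      · subst h2; rw [swapMult_right, val _ hk, val _ (by omega)]
      exact swapMult_of_ne _ h1 h2
    · rw [cable_gen hk, val _ hk, val _ (by omega), hp _ (by omega)]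
      simp [blockCross, strandCross]
  | mul a b ha hb =>
    rw [Mult.act_mul, cable_mul, hb.1, hb.2, ha.1, ha.2]
    exact ⟨rfl, rfl⟩
  | inv a ha =>
    have h := cable_inv (fibreMult OrderHom.id) a
    have h' := Mult.act_inv_act a (fibreMult OrderHom.id)
    rw [ha.1] at h h'
    rw [ha.2] at h
    exact ⟨h', h⟩

end Braid

section SimplicialGroups

/-- The category of Lie algebras over `ℤ`. -/
structure LieZ where
  /-- The underlying type. -/
  carrier : Type
  [lieRing : LieRing carrier]

attribute [instance] LieZ.lieRing

instance : Category LieZ where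
  Hom A B := A.carrier →ₗ⁅ℤ⁆ B.carrier
  id A := LieHom.id
  comp f g := g.comp f

/-- The functor `gr_*` from groups to Lie algebras over `ℤ`. -/
def grFunctor : GrpCat.{0} ⥤ LieZ where
  obj G := ⟨Gr G⟩
  map f := Gr.map f.hom
  map_id _ := Gr.map_id
  map_comp f g := Gr.map_comp g.hom f.hom

/-- The `E⁰`-term of the Bousfield–Kan spectral sequence of a simplicial group `G`, which is the
spectral sequence of the filtration of `G` by its descending central series: the simplicial Lie
algebra `gr_*(G_•)`, in simplicial degree `n` equal to `gr_*(G_n)`. -/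
def EZero : SimplicialObject GrpCat.{0} ⥤ SimplicialObject LieZ :=
  (SimplicialObject.whiskering GrpCat.{0} LieZ).obj grFunctor

/-- The simplicial group `AP` with `AP_n = P_{n+1}`. A monotone map `f : [m] → [n]` acts by
replacing the strand `k` by as many parallel strands as the fibre of `f` over `k` has elements. In
particular the face `d_i` deletes and the degeneracy `s_i` doubles the strand in position `i`. -/
def AP : SimplicialObject GrpCat.{0} where
  obj X := GrpCat.of (PureBraid (X.unop.len + 1))
  map f := GrpCat.ofHom (pureCable (fibreMult f.unop.toOrderHom))
  map_id X := by
    apply GrpCat.hom_ext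
    ext b
    exact (cable_fibreMult_id b.1).2
  map_comp f g := by
    apply GrpCat.hom_ext
    change pureCable (fibreMult (f.unop.toOrderHom.comp g.unop.toOrderHom)) = _
    rw [fibreMult_comp, pureCable_comp]
    rfl

/-- The homomorphism `P_{n+1} → P_{m+1}` induced by a monotone map `[m] → [n]`. -/
def APmap {X Y : SimplexCategory} (f : X ⟶ Y) :
    PureBraid (Y.len + 1) →* PureBraid (X.len + 1) := (AP.map f.op).hom

lemma APmap_comp {X Y Z : SimplexCategory} (f : X ⟶ Y) (g : Y ⟶ Z)
    (b : PureBraid (Z.len + 1)) : APmap (f ≫ g) b = APmap f (APmap g b) := by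
  simp only [APmap, op_comp, Functor.map_comp]
  rfl

/-- Artin's generator `A_{1,2} = σ²` of `P_2`, the full twist of two strands. -/
def fullTwist : PureBraid 2 :=
  ⟨braidGen 2 0 ^ 2, by
    rw [MonoidHom.mem_ker, map_pow, braidPerm_gen (by omega), pow_two, Equiv.swap_mul_self]⟩

/-- The cabled pure braid `x_{q+1}` in `P_{n+1}`, `0 ≤ q < n`: in the full twist of two strands the
first strand is replaced by `n - q` parallel strands and the second one by `q + 1` parallel
strands. -/
def cabledTwist (n : ℕ) (q : Fin n) : PureBraid (n + 1) :=
  APmap (SimplexCategory.toMk₁ (n := n) ⟨n - q, by omega⟩) fullTwist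

/-- The cabled braid as a word in the Artin generators. -/
lemma cabledTwist_val (n : ℕ) (q : Fin n) :
    (cabledTwist n q : BraidGroup (n + 1)) =
      blockCross (n + 1) 0 (q + 1) (n - q) * blockCross (n + 1) 0 (n - q) (q + 1) := by
  have hq := q.2
  let f : Fin (n + 1) →o Fin 2 :=
    (SimplexCategory.toMk₁ (n := n) ⟨n - q, by omega⟩).toOrderHom
  have hf : ∀ j, f j = if j.castSucc < (⟨n - q, by omega⟩ : Fin (n + 2)) then 0 else 1 :=
    fun j => rfl
  change cable (fibreMult f) (braidGen 2 0 ^ 2) = _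
  have h1 : psum (fibreMult f).1 1 = n - q := by
    rw [psum_fibreMult]
    have : (Finset.univ.filter fun j => (f j : ℕ) < 1) =
        Finset.Iio (⟨n - q, by omega⟩ : Fin (n + 1)) := by
      ext j
      simp only [Finset.mem_filter, Finset.mem_univ, true_and, Finset.mem_Iio, hf, Fin.lt_def,
        Fin.val_castSucc]
      split_ifs with h <;> simp [h]
    rw [this, Fin.card_Iio]
  have h2 : psum (fibreMult f).1 2 = n + 1 := (fibreMult f).2
  have h0 : psum (fibreMult f).1 0 = 0 := rfl
  have e0 : (fibreMult f).1 0 = n - q := by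
    rw [psum_succ, h0] at h1; omega
  have e1 : (fibreMult f).1 1 = q + 1 := by
    rw [psum_succ, h1] at h2; omega
  rw [pow_two, cable_mul, cable_gen (by omega), cable_gen (by omega), Mult.act_gen (by omega),
    swapMult_left, swapMult_right, psum_swapMult _ (by omega), h0]
  simp only [zero_add, e0, e1]

/-- The cabling homomorphism `Θ_n : F[y_1, …, y_n] → P_{n+1}`, `y_q ↦ x_q`. -/
def cablingHom (n : ℕ) : FreeGroup (Fin n) →* PureBraid (n + 1) :=
  FreeGroup.lift (cabledTwist n)

/-- The degenerate simplices `s_0^n(*)` on a vertex `pt` of a simplicial set. -/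
def basePoint (K : SSet.{0}) (pt : K.obj (op (SimplexCategory.mk 0))) (X : SimplexCategoryᵒᵖ) :
    K.obj X :=
  K.map (SimplexCategory.const X.unop (SimplexCategory.mk 0) 0).op pt

lemma map_basePoint (K : SSet.{0}) (pt : K.obj (op (SimplexCategory.mk 0)))
    {X Y : SimplexCategoryᵒᵖ} (f : X ⟶ Y) :
    K.map f (basePoint K pt X) = basePoint K pt Y := by
  rw [basePoint, basePoint, ← Functor.map_comp_apply]
  rfl

/-- The group `F[K]_n`: the free group on the set `K_n` modulo the relation `s_0^n(*) = 1`. -/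
abbrev MilnorGroup (K : SSet.{0}) (pt : K.obj (op (SimplexCategory.mk 0)))
    (X : SimplexCategoryᵒᵖ) : Type :=
  FreeGroup (K.obj X) ⧸ Subgroup.normalClosure {FreeGroup.of (basePoint K pt X)}

/-- The element of `F[K]_n` given by a simplex. -/
def milnorOf {K : SSet.{0}} (pt : K.obj (op (SimplexCategory.mk 0)))
    {X : SimplexCategoryᵒᵖ} (x : K.obj X) : MilnorGroup K pt X :=
  QuotientGroup.mk (FreeGroup.of x)

lemma milnorOf_basePoint {K : SSet.{0}} (pt : K.obj (op (SimplexCategory.mk 0)))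
    (X : SimplexCategoryᵒᵖ) : milnorOf pt (basePoint K pt X) = 1 :=
  (QuotientGroup.eq_one_iff _).2 (Subgroup.subset_normalClosure rfl)

/-- The homomorphism out of `F[K]_n` given by a map on the simplices. -/
def milnorLift {K : SSet.{0}} (pt : K.obj (op (SimplexCategory.mk 0)))
    {X : SimplexCategoryᵒᵖ} {G : Type*} [Group G] (f : K.obj X → G)
    (hf : f (basePoint K pt X) = 1) : MilnorGroup K pt X →* G :=
  QuotientGroup.lift _ (FreeGroup.lift f) (by
    refine Subgroup.normalClosure_le_normal ?_
    rintro _ rfl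
    simpa [MonoidHom.mem_ker] using hf)

lemma milnorLift_of {K : SSet.{0}} (pt : K.obj (op (SimplexCategory.mk 0)))
    {X : SimplexCategoryᵒᵖ} {G : Type*} [Group G] (f : K.obj X → G)
    (hf : f (basePoint K pt X) = 1) (x : K.obj X) :
    milnorLift pt f hf (milnorOf pt x) = f x := by
  change FreeGroup.lift f (FreeGroup.of x) = f x
  simp

lemma milnor_hom_ext {K : SSet.{0}} (pt : K.obj (op (SimplexCategory.mk 0)))
    {X : SimplexCategoryᵒᵖ} {G : Type*} [Group G] {f g : MilnorGroup K pt X →* G}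
    (h : ∀ x, f (milnorOf pt x) = g (milnorOf pt x)) : f = g := by
  refine QuotientGroup.monoidHom_ext _ ?_
  ext x
  exact h x

/-- Milnor's free simplicial group `F[K]` on a pointed simplicial set. -/
def MilnorF (K : SSet.{0}) (pt : K.obj (op (SimplexCategory.mk 0))) :
    SimplicialObject GrpCat.{0} where
  obj X := GrpCat.of (MilnorGroup K pt X)
  map f := GrpCat.ofHom (milnorLift pt (fun x => milnorOf pt (K.map f x)) (by
    rw [map_basePoint, milnorOf_basePoint]))
  map_id X := by
    apply GrpCat.hom_ext
    refine milnor_hom_ext pt fun x => ?_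
    rw [GrpCat.hom_ofHom, milnorLift_of, Functor.map_id_apply]
    rfl
  map_comp f g := by
    apply GrpCat.hom_ext
    refine milnor_hom_ext pt fun x => ?_
    rw [GrpCat.hom_ofHom, milnorLift_of, Functor.map_comp_apply, GrpCat.hom_comp,
      GrpCat.hom_ofHom, GrpCat.hom_ofHom, MonoidHom.comp_apply, milnorLift_of, milnorLift_of]

lemma MilnorF_map_of {K : SSet.{0}} (pt : K.obj (op (SimplexCategory.mk 0)))
    {X Y : SimplexCategoryᵒᵖ} (f : X ⟶ Y) (x : K.obj X) :
    ((MilnorF K pt).map f).hom (milnorOf pt x) = milnorOf pt (K.map f x) :=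
  milnorLift_of _ _ (by rw [map_basePoint]; exact milnorOf_basePoint _ _) _

/-- Two `n`-simplices of `Δ[1]` that are both constant, hence identified in the circle. -/
def BothConst (X : SimplexCategory) (a b : X ⟶ SimplexCategory.mk 1) : Prop :=
  (∃ v, a = SimplexCategory.const X _ v) ∧ ∃ v, b = SimplexCategory.const X _ v

lemma BothConst.comp {X Y : SimplexCategory} {a b : X ⟶ SimplexCategory.mk 1}
    (h : BothConst X a b) (f : Y ⟶ X) : BothConst Y (f ≫ a) (f ≫ b) := by
  obtain ⟨⟨v, rfl⟩, ⟨w, rfl⟩⟩ := h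
  exact ⟨⟨v, rfl⟩, ⟨w, rfl⟩⟩

/-- The simplicial circle `S¹ = Δ[1] / ∂Δ[1]`: its `n`-simplices are the monotone maps
`[n] → [1]`, with the constant ones identified. -/
def Circle1 : SSet.{0} where
  obj X := Quot (BothConst X.unop)
  map f := TypeCat.ofHom (Quot.map (fun a => f.unop ≫ a) fun _ _ h => h.comp f.unop)
  map_id X := by
    ext x
    induction x using Quot.ind with | _ a => ?_
    exact congrArg (Quot.mk _) (Category.id_comp a)
  map_comp f g := by
    ext x
    induction x using Quot.ind with | _ a => ?_
    exact congrArg (Quot.mk _) (Category.assoc _ _ a)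

/-- The class in `S¹` of a simplex of `Δ[1]`. -/
def Circle1.mk {X : SimplexCategory} (a : X ⟶ SimplexCategory.mk 1) : Circle1.obj (op X) :=
  Quot.mk _ a

/-- The base point of `S¹`. -/
def Circle1.pt : Circle1.obj (op (SimplexCategory.mk 0)) :=
  Circle1.mk (SimplexCategory.const _ _ 0)

lemma Circle1.mk_const {X : SimplexCategory} (v : Fin 2) :
    Circle1.mk (SimplexCategory.const X _ v) = basePoint Circle1 Circle1.pt (op X) :=
  Quot.sound ⟨⟨v, rfl⟩, ⟨0, rfl⟩⟩

/-- The simplicial group `F[S¹]`. -/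
abbrev FCircle : SimplicialObject GrpCat.{0} := MilnorF Circle1 Circle1.pt

/-- `P_1` is trivial. -/
lemma pureBraid_one (b : PureBraid 1) : b = 1 := by
  have key : ∀ b : BraidGroup 1, b = 1 := by
    intro b
    induction b using BraidGroup.induction with
    | one => rfl
    | gen i h => omega
    | mul a b ha hb => rw [ha, hb, one_mul]
    | inv a ha => rw [ha, inv_one]
  exact Subtype.ext (key b.1)

lemma APmap_const {X : SimplexCategory} (v : Fin 2) :
    APmap (SimplexCategory.const X (SimplexCategory.mk 1) v) fullTwist = 1 := by
  have : SimplexCategory.const X (SimplexCategory.mk 1) v =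
      SimplexCategory.const X (SimplexCategory.mk 0) 0 ≫
        SimplexCategory.const (SimplexCategory.mk 0) (SimplexCategory.mk 1) v := rfl
  rw [this, APmap_comp, pureBraid_one (APmap _ fullTwist), map_one]

/-- The values of `Θ` on the simplices of the circle: the class of a monotone map `a : [n] → [1]`
goes to the image of `A_{1,2}` under `a^* : P_2 → P_{n+1}`. -/
def thetaSimplex (X : SimplexCategoryᵒᵖ) : Circle1.obj X → PureBraid (X.unop.len + 1) :=
  Quot.lift (fun a => APmap a fullTwist) (by
    rintro _ _ ⟨⟨v, rfl⟩, ⟨w, rfl⟩⟩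
    rw [APmap_const, APmap_const])

/-- `Θ` in a single simplicial degree. -/
def thetaHom (X : SimplexCategoryᵒᵖ) :
    MilnorGroup Circle1 Circle1.pt X →* PureBraid (X.unop.len + 1) :=
  milnorLift Circle1.pt (thetaSimplex X) (APmap_const (X := X.unop) 0)

lemma thetaHom_mk {X : SimplexCategory} (a : X ⟶ SimplexCategory.mk 1) :
    thetaHom (op X) (milnorOf Circle1.pt (Circle1.mk a)) = APmap a fullTwist :=
  milnorLift_of _ _ _ _

/-- The cabling morphism of simplicial groups `Θ : F[S¹] → AP`, with `Θ_1(y_1) = A_{1,2}`. -/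
def Theta : FCircle ⟶ AP where
  app X := GrpCat.ofHom (thetaHom X)
  naturality X Y f := by
    apply GrpCat.hom_ext
    refine milnor_hom_ext Circle1.pt fun x => ?_
    obtain ⟨a, rfl⟩ := Quot.exists_rep x
    have h1 : (FCircle.map f).hom (milnorOf Circle1.pt (Circle1.mk a)) =
        milnorOf Circle1.pt (Circle1.mk (f.unop ≫ a)) := MilnorF_map_of _ f (Circle1.mk a)
    have h2 : thetaHom Y ((FCircle.map f).hom (milnorOf Circle1.pt (Circle1.mk a))) =
        APmap f.unop (thetaHom X (milnorOf Circle1.pt (Circle1.mk a))) :=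
      (congrArg (thetaHom Y) h1).trans <| (thetaHom_mk (f.unop ≫ a)).trans <|
        (APmap_comp f.unop a fullTwist).trans (congrArg (APmap f.unop) (thetaHom_mk a).symm)
    exact h2

/-- The simplex of the circle labelled `y_{q+1}`, the class of the monotone map `[n] → [1]` that
takes `n - q` times the value `0` and `q + 1` times the value `1`. -/
def circleSimplex (n : ℕ) (q : Fin n) : Circle1.obj (op (SimplexCategory.mk n)) :=
  Circle1.mk (SimplexCategory.toMk₁ (n := n) ⟨n - q, by omega⟩)

/-- The homomorphism `F[y_1, …, y_n] → F[S¹]_n`. -/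
def circleFree (n : ℕ) :
    FreeGroup (Fin n) →* MilnorGroup Circle1 Circle1.pt (op (SimplexCategory.mk n)) :=
  FreeGroup.lift fun q => milnorOf Circle1.pt (circleSimplex n q)

lemma toMk_zero (n : ℕ) : SimplexCategory.toMk₁ (n := n) 0 = SimplexCategory.const _ _ 1 := by
  refine ConcreteCategory.hom_ext _ _ fun j => ?_
  exact SimplexCategory.toMk₁_of_le_castSucc _ _ (Fin.zero_le _)

lemma toMk_last (n : ℕ) :
    SimplexCategory.toMk₁ (n := n) (Fin.last _) = SimplexCategory.const _ _ 0 := by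
  refine ConcreteCategory.hom_ext _ _ fun j => ?_
  exact SimplexCategory.toMk₁_of_castSucc_lt _ _ (Fin.castSucc_lt_last _)

/-- The free generator that corresponds to the monotone map `[n] → [1]` with `i` values `0`. -/
def circleGen (n : ℕ) (i : Fin (n + 2)) : FreeGroup (Fin n) :=
  if h : 0 < (i : ℕ) ∧ (i : ℕ) < n + 1 then FreeGroup.of ⟨n - i, by omega⟩ else 1

/-- `F[S¹]_n` is free on `y_1, …, y_n`. -/
lemma circleFree_bijective (n : ℕ) : Function.Bijective (circleFree n) := by
  have hc : ∀ v, circleGen n (SimplexCategory.toMk₁Equiv.symm (SimplexCategory.const _ _ v)) = 1 := by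
    intro v
    fin_cases v
    · change circleGen n (SimplexCategory.toMk₁Equiv.symm (SimplexCategory.const _ _ 0)) = 1
      rw [← toMk_last, ← SimplexCategory.toMk₁Equiv_apply, Equiv.symm_apply_apply, circleGen,
        dif_neg (by simp)]
    · change circleGen n (SimplexCategory.toMk₁Equiv.symm (SimplexCategory.const _ _ 1)) = 1
      rw [← toMk_zero, ← SimplexCategory.toMk₁Equiv_apply, Equiv.symm_apply_apply, circleGen,
        dif_neg (by simp)]
  let s : Circle1.obj (op (SimplexCategory.mk n)) → FreeGroup (Fin n) :=
    Quot.lift (fun a => circleGen n (SimplexCategory.toMk₁Equiv.symm a)) (by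
      rintro _ _ ⟨⟨v, rfl⟩, ⟨w, rfl⟩⟩
      exact (hc v).trans (hc w).symm)
  have hs : ∀ i, s (Circle1.mk (SimplexCategory.toMk₁ i)) = circleGen n i := by
    intro i
    change circleGen n (SimplexCategory.toMk₁Equiv.symm (SimplexCategory.toMk₁ i)) = _
    rw [← SimplexCategory.toMk₁Equiv_apply, Equiv.symm_apply_apply]
  let g : MilnorGroup Circle1 Circle1.pt (op (SimplexCategory.mk n)) →* FreeGroup (Fin n) :=
    milnorLift Circle1.pt s (hc 0)
  have h1 : g.comp (circleFree n) = MonoidHom.id _ := by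
    ext q : 1
    have hq := q.2
    rw [MonoidHom.comp_apply, circleFree, FreeGroup.lift_apply_of]
    refine (milnorLift_of _ _ _ _).trans ((hs _).trans ?_)
    rw [circleGen, dif_pos ⟨by simp only; omega, by simp only; omega⟩]
    simp only [MonoidHom.id_apply]
    congr 1
    ext
    simp only
    omega
  have h2 : (circleFree n).comp g = MonoidHom.id _ := by
    refine milnor_hom_ext Circle1.pt fun x => ?_
    obtain ⟨a, rfl⟩ := Quot.exists_rep x
    obtain ⟨i, rfl⟩ := SimplexCategory.toMk₁_surjective a
    refine (congrArg (circleFree n) ((milnorLift_of Circle1.pt s (hc 0) _).trans (hs i))).trans ?_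
    rw [circleGen]
    split_ifs with h
    · rw [circleFree, FreeGroup.lift_apply_of, circleSimplex]
      have : (⟨n - (n - i), by omega⟩ : Fin (n + 2)) = i := by ext; simp only; omega
      simp only [this]
      rfl
    · have hi := i.2
      have : i = 0 ∨ i = Fin.last _ := by
        simp only [Fin.ext_iff, Fin.val_zero, Fin.val_last]
        omega
      rw [map_one]
      rcases this with rfl | rfl
      · rw [toMk_zero]
        exact (milnorOf_basePoint Circle1.pt _).symm.trans
          (congrArg (milnorOf Circle1.pt) (Circle1.mk_const 1).symm)
      · rw [toMk_last]
        exact (milnorOf_basePoint Circle1.pt _).symm.trans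
          (congrArg (milnorOf Circle1.pt) (Circle1.mk_const 0).symm)
  exact ⟨Function.LeftInverse.injective (g := g) fun w => DFunLike.congr_fun h1 w,
    Function.RightInverse.surjective (g := g) fun w => DFunLike.congr_fun h2 w⟩

/-- Under the identification of `F[S¹]_n` with `F[y_1, …, y_n]`, the morphism `Θ` is `Θ_n` in
degree `n`. -/
lemma thetaHom_circleFree (n : ℕ) (w : FreeGroup (Fin n)) :
    thetaHom (op (SimplexCategory.mk n)) (circleFree n w) = cablingHom n w := by
  have : (thetaHom (op (SimplexCategory.mk n))).comp (circleFree n) = cablingHom n := by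
    ext q : 1
    rw [MonoidHom.comp_apply, circleFree, FreeGroup.lift_apply_of, cablingHom,
      FreeGroup.lift_apply_of]
    exact thetaHom_mk _
  exact DFunLike.congr_fun this w

/-- A morphism in the category `LieZ` as a morphism of Lie algebras. -/
def LieZ.toLieHom {A B : LieZ} (f : A ⟶ B) : A.carrier →ₗ⁅ℤ⁆ B.carrier := f

end SimplicialGroups

/-! Let F be the free group on E_1, …, E_n (`loopAround`), regarded as the fundamental group of the
sphere without n+1 points, with E_k the loop around the first k points. Under Artin's action a pure
braid sends the loop around each point to a conjugate of itself, and a framing makes a definite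
choice of the conjugator. The inverse conjugator at the first point is a crossed homomorphism
`strandFrame` from P_{n+1} to F: w(ab) = w(a) · a(w(b)). Its composite with Θ_n is a self-map v of
F, `cablingFrame`. The plan is to show that v detects the descending central series; Θ_n then does
so too.

Pure braids act trivially on the abelianization of F. Hence Γ^i(P) moves Γ^j(F) only by elements of
Γ^{i+j}(F) (`action_mul_inv_mem_Gam`), crossed homomorphisms preserve the descending central series
(`crossedHom_mem_Gam`), and v induces additive endomorphisms of the graded pieces of F, although v
itself is not a homomorphism.

The map v is surjective. The generator whose cabled twist has p strands in its first ribbon goes to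
E_p, and this twist acts by an automorphism D that conjugates E_l by E_p^{-1} for l ≤ p and by E_p
for l ≥ p (`isTwistFamily_ribbonTwist`). The image of v therefore contains 1 and is stable under the
bijections a ↦ E_p D(a) and their inverses. By `IsTwistFamily.subset_of_twist`, the combinatorial
core, such a set is all of F.

A surjective endomorphism of a finitely generated abelian group is injective, so by induction on the
degree v(w) ∈ Γ^i implies w ∈ Γ^i (`mem_Gam_of_surjective`). Consequently Θ_n(w) ∈ Γ^i implies w ∈
Γ^i (`mem_Gam_of_cablingHom_mem`). This strictness is exactly what makes gr_*(Θ_n) injective, and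
with the residual nilpotence of free groups (Magnus expansion) it makes Θ_n injective. The statement
on E^0 is the same fact transported along the isomorphism of F[y_1, …, y_n] with F[S^1]_n. For the
projections to P_2, a suitable single x_q already maps to the full twist, which generates P_2. -/

/-! ### Sets invariant under twisted translations of a group. -/

section TwistedTranslations

variable {F : Type*} [Group F]

/-- The subgroup generated by the first `m` terms of a sequence. -/
def initialSubgroup (X : ℕ → F) (m : ℕ) : Subgroup F := Subgroup.closure (X '' Set.Iio m)

lemma mem_initialSubgroup (X : ℕ → F) {l m : ℕ} (h : l < m) : X l ∈ initialSubgroup X m :=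
  Subgroup.subset_closure ⟨l, h, rfl⟩

lemma initialSubgroup_mono (X : ℕ → F) {l m : ℕ} (h : l ≤ m) :
    initialSubgroup X l ≤ initialSubgroup X m :=
  Subgroup.closure_mono (Set.image_mono (Set.Iio_subset_Iio h))

/-- The automorphism `D k` conjugates the terms `X l`, `l ≤ k`, by `(X k)⁻¹` and the terms `X l`,
`k ≤ l`, by `X k`, for indices below `n`. -/
structure IsTwistFamily (X : ℕ → F) (D : ℕ → MulAut F) (n : ℕ) : Prop where
  le : ∀ k l, l ≤ k → k < n → D k (X l) = (X k)⁻¹ * X l * X k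
  ge : ∀ k l, k ≤ l → l < n → D k (X l) = X k * X l * (X k)⁻¹

namespace IsTwistFamily

variable {X : ℕ → F} {D : ℕ → MulAut F} {n : ℕ}

lemma self (h : IsTwistFamily X D n) {k : ℕ} (hk : k < n) : D k (X k) = X k := by
  simp [h.ge k k le_rfl hk]

lemma apply_mem (h : IsTwistFamily X D n) {k m : ℕ} (hk : k < m) (hm : m ≤ n) {a : F}
    (ha : a ∈ initialSubgroup X m) : D k a ∈ initialSubgroup X m := by
  have hX := mem_initialSubgroup X hk
  suffices initialSubgroup X m ≤ (initialSubgroup X m).comap (D k).toMonoidHom from this ha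
  refine (Subgroup.closure_le _).2 ?_
  rintro _ ⟨l, hl, rfl⟩
  change D k (X l) ∈ initialSubgroup X m
  have hl' := mem_initialSubgroup X hl
  rcases le_total l k with hlk | hlk
  · rw [h.le k l hlk (by omega)]
    exact mul_mem (mul_mem (inv_mem hX) hl') hX
  · rw [h.ge k l hlk (lt_of_lt_of_le hl hm)]
    exact mul_mem (mul_mem hX hl') (inv_mem hX)

/-- Since `D k` fixes `X k`, its inverse is given on the generators by the opposite conjugations. So
`D k` restricts to a bijection of the initial subgroup, as the equivalences below require. -/
lemma symm_apply_mem (h : IsTwistFamily X D n) {k m : ℕ} (hk : k < m) (hm : m ≤ n) {a : F}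
    (ha : a ∈ initialSubgroup X m) : (D k).symm a ∈ initialSubgroup X m := by
  have hX := mem_initialSubgroup X hk
  suffices initialSubgroup X m ≤ (initialSubgroup X m).comap (D k).symm.toMonoidHom from this ha
  refine (Subgroup.closure_le _).2 ?_
  rintro _ ⟨l, hl, rfl⟩
  change (D k).symm (X l) ∈ initialSubgroup X m
  have hl' := mem_initialSubgroup X hl
  rcases le_total l k with hlk | hlk
  · rw [(MulEquiv.symm_apply_eq _).2 (show X l = D k (X k * X l * (X k)⁻¹) by
      rw [map_mul, map_mul, map_inv, h.self (by omega), h.le k l hlk (by omega)]; group)]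
    exact mul_mem (mul_mem hX hl') (inv_mem hX)
  · have hln : l < n := lt_of_lt_of_le hl hm
    rw [(MulEquiv.symm_apply_eq _).2 (show X l = D k ((X k)⁻¹ * X l * X k) by
      rw [map_mul, map_mul, map_inv, h.self (by omega), h.ge k l hlk hln]; group)]
    exact mul_mem (mul_mem (inv_mem hX) hl') hX

/-- On the subgroup where `m` is the largest index, only the first kind of conjugation occurs, so
the twist is inner there. This is what starts both inductions below. -/
lemma apply_of_mem (h : IsTwistFamily X D n) {m : ℕ} (hm : m < n) {a : F}
    (ha : a ∈ initialSubgroup X (m + 1)) : D m a = (X m)⁻¹ * a * X m := by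
  have : Set.EqOn (D m).toMonoidHom (MulAut.conj (X m)⁻¹).toMonoidHom
      (initialSubgroup X (m + 1)) := by
    refine MonoidHom.eqOn_closure ?_
    rintro _ ⟨l, hl, rfl⟩
    change D m (X l) = MulAut.conj (X m)⁻¹ (X l)
    rw [MulAut.conj_apply, inv_inv]
    exact h.le m l (Nat.lt_succ_iff.1 hl) hm
  have := this ha
  change D m a = MulAut.conj (X m)⁻¹ a at this
  rwa [MulAut.conj_apply, inv_inv] at this

lemma apply_zpow (h : IsTwistFamily X D n) {k m : ℕ} (hk : k ≤ m) (hm : m < n) (j : ℤ) :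
    D k (X m ^ j) = X k * X m ^ j * (X k)⁻¹ := by
  rw [map_zpow, h.ge k m hk hm, conj_zpow]

/-- A set that contains `1` and is invariant under the bijections `a ↦ (X k)⁻¹ * D k a` for `k < m`
contains the subgroup generated by the `X k` for `k < m`. -/
theorem subset_of_inv_twist (h : IsTwistFamily X D n) {m : ℕ} (hm : m ≤ n) (O : Set F)
    (one : 1 ∈ O) (inv : ∀ k < m, ∀ a, (X k)⁻¹ * D k a ∈ O ↔ a ∈ O) {a : F}
    (ha : a ∈ initialSubgroup X m) :
    a ∈ O := by
  -- The set varies in the induction: the hypothesis is applied to sets of right factors `d` that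
  -- complete a given element to one of `O`.
  induction m generalizing O a with
  | zero =>
    have : a = 1 := by simpa [initialSubgroup] using ha
    rwa [this]
  | succ m ih =>
    have hmn : m < n := hm
    have hXm := mem_initialSubgroup X (Nat.lt_succ_self m)
    -- As `D m` is conjugation by `(X m)⁻¹` here, the move with `k = m` is a ↦ (X m)⁻² a (X m). It
    -- trades right powers of `X m` for left ones.
    have last : ∀ a ∈ initialSubgroup X (m + 1), ∀ j : ℤ, (X m ^ (-2 * j) * a * X m ^ j ∈ O ↔
        a ∈ O) := by
      have step : ∀ a ∈ initialSubgroup X (m + 1), (X m ^ (-2 : ℤ) * a * X m ∈ O ↔ a ∈ O) := by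
        intro a ha
        rw [← inv m (Nat.lt_succ_self m) a, h.apply_of_mem hmn ha]
        refine iff_of_eq (congrArg (· ∈ O) ?_)
        group
      intro a ha j
      induction j using Int.induction_on with
      | zero => simp
      | succ j hj =>
        rw [← hj, ← step (X m ^ (-2 * (j : ℤ)) * a * X m ^ (j : ℤ)) (mul_mem (mul_mem
          (zpow_mem hXm _) ha) (zpow_mem hXm _))]
        refine iff_of_eq (congrArg (· ∈ O) ?_)
        simp only [mul_add, zpow_add]; group
      | pred j hj =>
        rw [← hj, ← step (X m ^ (-2 * (-(j : ℤ) - 1)) * a * X m ^ (-(j : ℤ) - 1)) (mul_mem (mul_mem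
          (zpow_mem hXm _) ha) (zpow_mem hXm _))]
        refine iff_of_eq (congrArg (· ∈ O) ?_)
        group
    -- The `j`-th iterate of the move takes (X m)^j to (X m)^(-2j + j + j) = 1.
    have powers : ∀ j : ℤ, X m ^ j ∈ O := by
      intro j
      rw [← last _ (zpow_mem hXm _) j]
      convert one using 1
      group
    -- The factor `d` absorbs right multiplication by generators of smaller index. The free left
    -- power of `X m` absorbs what `last` produces when a right power of `X m` is removed.
    let p : F → Prop := fun a => a ∈ initialSubgroup X (m + 1) ∧
      ∀ j : ℤ, ∀ d ∈ initialSubgroup X m, X m ^ j * a * d ∈ O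
    have p_iff : ∀ k < m, ∀ a, p ((X k)⁻¹ * D k a * X k) ↔ p a := by
      intro k hk a
      have hXk := mem_initialSubgroup X hk
      have hXk' := initialSubgroup_mono X (Nat.le_succ m) hXk
      -- For k < m the twist `D k` conjugates powers of `X m` by `X k`, so the move passes through
      -- the left power unchanged. What remains on `d` is a bijection of the smaller subgroup.
      have e : ∀ (j : ℤ) (d : F), X m ^ j * ((X k)⁻¹ * D k a * X k) * d =
          (X k)⁻¹ * D k (X m ^ j * a * (D k).symm (X k * d)) := by
        intro j d
        rw [map_mul, map_mul, h.apply_zpow hk.le hmn, MulEquiv.apply_symm_apply]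
        group
      refine and_congr ⟨fun ha => ?_, fun ha => ?_⟩ (forall_congr' fun j => ⟨fun H d hd => ?_,
        fun H d hd => ?_⟩)
      · rw [← (D k).symm_apply_apply a]
        refine h.symm_apply_mem (by omega) hm ?_
        have := mul_mem (mul_mem hXk' ha) (inv_mem hXk')
        convert this using 1
        group
      · exact mul_mem (mul_mem (inv_mem hXk') (h.apply_mem (by omega) hm ha)) hXk'
      · have := H ((X k)⁻¹ * D k d) (mul_mem (inv_mem hXk) (h.apply_mem hk (by omega) hd))
        rw [e, inv k (by omega), mul_inv_cancel_left, MulEquiv.symm_apply_apply] at this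
        exact this
      · rw [e, inv k (by omega)]
        exact H _ (h.symm_apply_mem hk (by omega) (mul_mem hXk hd))
    have p_one : p 1 := by
      refine ⟨one_mem _, fun j d hd => ?_⟩
      rw [mul_one]
      refine ih (by omega) {d | X m ^ j * d ∈ O} (by simpa using powers j) (fun k hk d => ?_) hd
      change X m ^ j * ((X k)⁻¹ * D k d) ∈ O ↔ X m ^ j * d ∈ O
      rw [← inv k (by omega) (X m ^ j * d), map_mul, h.apply_zpow hk.le hmn]
      refine iff_of_eq (congrArg (· ∈ O) ?_)
      group
    have p_mul_zpow : ∀ (e : ℤ) a, p a → p (a * X m ^ e) := by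
      intro e a ha
      refine ⟨mul_mem ha.1 (zpow_mem hXm _), fun j d hd => ?_⟩
      -- The quantifier over `a` is essential: a move on the whole product performs the same kind of
      -- move on `d` but also replaces `a` by (X k)⁻¹ D_k(a) X k, which `p_iff` permits.
      refine ih (by omega) {d | ∀ a, p a → ∀ j : ℤ, X m ^ j * (a * X m ^ e) * d ∈ O} ?_ ?_ hd a ha j
      · intro a ha j
        -- The exponent `-e` cancels the right power and leaves 2e more on the left, which `p a`
        -- tolerates.
        rw [mul_one, ← last _ (mul_mem (zpow_mem hXm _) (mul_mem ha.1 (zpow_mem hXm _))) (-e)]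
        convert ha.2 (-2 * -e + j) 1 (one_mem _) using 1
        rw [zpow_add]; group
      · intro k hk d
        have key : ∀ (a : F) (j : ℤ),
            (X m ^ j * (((X k)⁻¹ * D k a * X k) * X m ^ e) * ((X k)⁻¹ * D k d) ∈ O ↔
              X m ^ j * (a * X m ^ e) * d ∈ O) := by
          intro a j
          rw [← inv k (by omega) (X m ^ j * (a * X m ^ e) * d), map_mul, map_mul, map_mul,
            h.apply_zpow hk.le hmn, h.apply_zpow hk.le hmn]
          refine iff_of_eq (congrArg (· ∈ O) ?_)
          group
        constructor
        · intro H a ha j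
          exact (key a j).1 (H _ ((p_iff k hk a).2 ha) j)
        · intro H a ha j
          obtain ⟨b, rfl⟩ : ∃ b, a = (X k)⁻¹ * D k b * X k :=
            ⟨(D k).symm (X k * a * (X k)⁻¹), by rw [MulEquiv.apply_symm_apply]; group⟩
          exact (key b j).2 (H b ((p_iff k hk b).1 ha) j)
    have p_mul : ∀ l < m + 1, ∀ (e : ℤ) a, p a → p (a * X l ^ e) := by
      intro l hl e a ha
      rcases Nat.lt_succ_iff_lt_or_eq.1 hl with hl' | rfl
      · have hXl := zpow_mem (mem_initialSubgroup X hl') e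
        refine ⟨mul_mem ha.1 (initialSubgroup_mono X (Nat.le_succ m) hXl), fun j d hd => ?_⟩
        have := ha.2 j (X l ^ e * d) (mul_mem hXl hd)
        rwa [← mul_assoc, mul_assoc (X m ^ j)] at this
      · exact p_mul_zpow e a ha
    have p_all : p a := by
      induction ha using Subgroup.closure_induction_right with
      | one => exact p_one
      | mul_right a ha b hb hp =>
        obtain ⟨l, hl, rfl⟩ := hb
        simpa using p_mul l hl 1 a hp
      | mul_inv_cancel a ha b hb hp =>
        obtain ⟨l, hl, rfl⟩ := hb
        simpa using p_mul l hl (-1) a hp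
    simpa using p_all.2 0 1 (one_mem _)

/-- A set that contains `1` and is invariant under the bijections `a ↦ X k * D k a` for `k < m`
contains the subgroup generated by the `X k` for `k < m`. -/
theorem subset_of_twist (h : IsTwistFamily X D n) {m : ℕ} (hm : m ≤ n) (O : Set F)
    (one : 1 ∈ O) (inv : ∀ k < m, ∀ a, X k * D k a ∈ O ↔ a ∈ O) {a : F}
    (ha : a ∈ initialSubgroup X m) :
    a ∈ O := by
  induction m generalizing O a with
  | zero =>
    have : a = 1 := by simpa [initialSubgroup] using ha
    rwa [this]
  | succ m ih =>
    have hmn : m < n := hm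
    have hXm := mem_initialSubgroup X (Nat.lt_succ_self m)
    -- Here the move with `k = m` is X m · (X m)⁻¹ a X m = a X m, plain right multiplication, so no
    -- left power is needed in `p`.
    have last : ∀ (j : ℤ), ∀ a ∈ initialSubgroup X (m + 1), (a * X m ^ j ∈ O ↔ a ∈ O) := by
      have step : ∀ a ∈ initialSubgroup X (m + 1), (a * X m ∈ O ↔ a ∈ O) := by
        intro a ha
        rw [← inv m (Nat.lt_succ_self m) a, h.apply_of_mem hmn ha]
        refine iff_of_eq (congrArg (· ∈ O) ?_)
        group
      intro j a ha
      induction j using Int.induction_on with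
      | zero => simp
      | succ j hj =>
        rw [← hj, ← step (a * X m ^ (j : ℤ)) (mul_mem ha (zpow_mem hXm _)), zpow_add_one, mul_assoc]
      | pred j hj =>
        rw [← hj, ← step (a * X m ^ (-(j : ℤ) - 1)) (mul_mem ha (zpow_mem hXm _)), mul_assoc,
          ← zpow_add_one, sub_add_cancel]
    let p : F → Prop := fun a => a ∈ initialSubgroup X (m + 1) ∧
      ∀ d ∈ initialSubgroup X m, a * d ∈ O
    have p_iff : ∀ k < m, ∀ a, p (X k * D k a * X k) ↔ p a := by
      intro k hk a
      have hXk := mem_initialSubgroup X hk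
      have hXk' := initialSubgroup_mono X (Nat.le_succ m) hXk
      have e : ∀ (d : F), X k * D k a * X k * d = X k * D k (a * (D k).symm (X k * d)) := by
        intro d
        rw [map_mul, MulEquiv.apply_symm_apply]
        group
      refine and_congr ⟨fun ha => ?_, fun ha => ?_⟩ ⟨fun H d hd => ?_, fun H d hd => ?_⟩
      · rw [← (D k).symm_apply_apply a]
        refine h.symm_apply_mem (by omega) hm ?_
        have := mul_mem (mul_mem (inv_mem hXk') ha) (inv_mem hXk')
        convert this using 1
        group
      · exact mul_mem (mul_mem hXk' (h.apply_mem (by omega) hm ha)) hXk'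
      · have := H ((X k)⁻¹ * D k d) (mul_mem (inv_mem hXk) (h.apply_mem hk (by omega) hd))
        rw [e, inv k (by omega), mul_inv_cancel_left, MulEquiv.symm_apply_apply] at this
        exact this
      · rw [e, inv k (by omega)]
        exact H _ (h.symm_apply_mem hk (by omega) (mul_mem hXk hd))
    have p_one : p 1 := ⟨one_mem _, fun d hd => by
      rw [one_mul]
      exact ih (by omega) O one (fun k hk => inv k (by omega)) hd⟩
    have p_mul_zpow : ∀ (e : ℤ) a, p a → p (a * X m ^ e) := by
      intro e a ha
      refine ⟨mul_mem ha.1 (zpow_mem hXm _), fun d hd => ?_⟩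
      -- Applying X k · D_k to a (X m)^e d gives (X k D_k(a) X k) (X m)^e ((X k)⁻¹ D_k(d)): moving
      -- past the power of `X m` inverts the translation part of the move on `d`. Hence the
      -- companion theorem for inverse twists takes the place of the induction hypothesis.
      refine h.subset_of_inv_twist hmn.le {d | ∀ a, p a → a * X m ^ e * d ∈ O} ?_ ?_ hd a ha
      · intro a ha
        rw [mul_one, last e a ha.1]
        simpa using ha.2 1 (one_mem _)
      · intro k hk d
        have key : ∀ a : F, (X k * D k a * X k * X m ^ e * ((X k)⁻¹ * D k d) ∈ O ↔
              a * X m ^ e * d ∈ O) := by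
          intro a
          rw [← inv k (by omega) (a * X m ^ e * d), map_mul, map_mul, h.apply_zpow hk.le hmn]
          refine iff_of_eq (congrArg (· ∈ O) ?_)
          group
        constructor
        · intro H a ha
          exact (key a).1 (H _ ((p_iff k hk a).2 ha))
        · intro H a ha
          obtain ⟨b, rfl⟩ : ∃ b, a = X k * D k b * X k :=
            ⟨(D k).symm ((X k)⁻¹ * a * (X k)⁻¹), by rw [MulEquiv.apply_symm_apply]; group⟩
          exact (key b).2 (H b ((p_iff k hk b).1 ha))
    have p_mul : ∀ l < m + 1, ∀ (e : ℤ) a, p a → p (a * X l ^ e) := by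
      intro l hl e a ha
      rcases Nat.lt_succ_iff_lt_or_eq.1 hl with hl' | rfl
      · have hXl := zpow_mem (mem_initialSubgroup X hl') e
        refine ⟨mul_mem ha.1 (initialSubgroup_mono X (Nat.le_succ m) hXl), fun d hd => ?_⟩
        have := ha.2 (X l ^ e * d) (mul_mem hXl hd)
        rwa [← mul_assoc] at this
      · exact p_mul_zpow e a ha
    have p_all : p a := by
      induction ha using Subgroup.closure_induction_right with
      | one => exact p_one
      | mul_right a ha b hb hp =>
        obtain ⟨l, hl, rfl⟩ := hb
        simpa using p_mul l hl 1 a hp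
      | mul_inv_cancel a ha b hb hp =>
        obtain ⟨l, hl, rfl⟩ := hb
        simpa using p_mul l hl (-1) a hp
    simpa using p_all.2 1 (one_mem _)

end IsTwistFamily

end TwistedTranslations

/-! ### Actions trivial on the abelianization, crossed homomorphisms and descending central series.
-/

section CrossedHom

/-- The three subgroups lemma, applied in the quotient by `N`. -/
lemma Subgroup.commutator_commutator_le_of_rotate {E : Type*} [Group E] {A B C N : Subgroup E}
    [N.Normal] (h1 : ⁅⁅B, C⁆, A⁆ ≤ N) (h2 : ⁅⁅C, A⁆, B⁆ ≤ N) : ⁅⁅A, B⁆, C⁆ ≤ N := by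
  let q := QuotientGroup.mk' N
  have toBot : ∀ A : Subgroup E, A ≤ N ↔ A.map q = ⊥ := by
    intro A
    rw [Subgroup.map_eq_bot_iff, QuotientGroup.ker_mk']
  rw [toBot] at h1 h2 ⊢
  simp only [Subgroup.map_commutator] at h1 h2 ⊢
  exact Subgroup.commutator_commutator_eq_bot_of_rotate h1 h2

/-- A descending series of normal subgroups that is central with respect to the whole group is
shifted by `i + 1` under commutators with the `i`-th stage of the descending central series. -/
lemma commutator_Gam_le {E : Type*} [Group E] (γ : ℕ → Subgroup E) [∀ j, (γ j).Normal]
    (h : ∀ j, ⁅γ j, (⊤ : Subgroup E)⁆ ≤ γ (j + 1)) (i j : ℕ) :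
    ⁅γ j, Gam E i⁆ ≤ γ (i + j + 1) := by
  induction i generalizing j with
  | zero => simpa using h j
  | succ i ih =>
    rw [Subgroup.commutator_comm]
    change ⁅⁅Gam E i, (⊤ : Subgroup E)⁆, γ j⁆ ≤ _
    have h1 : ⁅⁅(⊤ : Subgroup E), γ j⁆, Gam E i⁆ ≤ γ (i + 1 + j + 1) := by
      rw [Subgroup.commutator_comm ⊤]
      refine (Subgroup.commutator_mono (h j) le_rfl).trans ((ih (j + 1)).trans ?_)
      rw [show i + (j + 1) + 1 = i + 1 + j + 1 by ring]
    have h2 : ⁅⁅γ j, Gam E i⁆, (⊤ : Subgroup E)⁆ ≤ γ (i + 1 + j + 1) := by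
      refine (Subgroup.commutator_mono (ih j) le_rfl).trans ((h _).trans ?_)
      rw [show i + j + 1 + 1 = i + 1 + j + 1 by ring]
    exact Subgroup.commutator_commutator_le_of_rotate h1 h2

variable {F P : Type*} [Group F] [Group P] (α : P →* MulAut F)

/-- The stages of the descending central series of the kernel of a split extension. -/
def kernelGam (j : ℕ) : Subgroup (F ⋊[α] P) := (Gam F j).map SemidirectProduct.inl

lemma inl_mem_kernelGam {j : ℕ} {a : F} :
    (SemidirectProduct.inl a : F ⋊[α] P) ∈ kernelGam α j ↔ a ∈ Gam F j :=
  Subgroup.mem_map_iff_mem SemidirectProduct.inl_injective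

lemma SemidirectProduct.conj_inl (x : F ⋊[α] P) (a : F) :
    x * inl a * x⁻¹ = inl (x.left * α x.right a * x.left⁻¹) := by
  rw [← SemidirectProduct.inl_left_mul_inr_right x]
  simp only [map_mul, map_inv, SemidirectProduct.inl_aut, mul_inv_rev, mul_assoc,
    SemidirectProduct.left_inl, SemidirectProduct.mul_left, SemidirectProduct.mul_right,
    SemidirectProduct.right_inl, SemidirectProduct.left_inr, SemidirectProduct.right_inr, map_one,
    mul_one, one_mul]

instance (j : ℕ) : (kernelGam α j).Normal where
  conj_mem := by
    rintro _ ⟨a, ha, rfl⟩ x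
    rw [SemidirectProduct.conj_inl, inl_mem_kernelGam]
    exact Gam_conj_mem _ (Gam_map (α x.right).toMonoidHom ha)

/-- In stage 0 a commutator with an arbitrary element is a commutator in F times a displacement
α_g(a) a⁻¹, and both lie in `Gam F 1`. Higher stages are commutators [γ_j, γ_0], to which the three
subgroups lemma applies. So triviality on the abelianization implies triviality on every graded
piece. -/
lemma kernelGam_commutator_le (hα : ∀ g a, α g a * a⁻¹ ∈ Gam F 1) (j : ℕ) :
    ⁅kernelGam α j, (⊤ : Subgroup (F ⋊[α] P))⁆ ≤ kernelGam α (j + 1) := by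
  have h0 : ⁅kernelGam α 0, (⊤ : Subgroup (F ⋊[α] P))⁆ ≤ kernelGam α 1 := by
    rw [Subgroup.commutator_comm, Subgroup.commutator_le]
    rintro x - _ ⟨a, -, rfl⟩
    rw [commutatorElement_def, SemidirectProduct.conj_inl, ← map_inv, ← map_mul, inl_mem_kernelGam]
    have h1 := hα x.right a
    have h2 : ⁅x.left, α x.right a⁆ ∈ Gam F 1 :=
      Gam_comm_mem 0 0 (Subgroup.mem_top _) (Subgroup.mem_top _)
    convert mul_mem h2 h1 using 1
    rw [commutatorElement_def]; group
  induction j with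
  | zero => exact h0
  | succ j ih =>
    have e : kernelGam α (j + 1) = ⁅kernelGam α j, kernelGam α 0⁆ :=
      Subgroup.map_commutator _ _ _
    have e' : kernelGam α (j + 1 + 1) = ⁅kernelGam α (j + 1), kernelGam α 0⁆ :=
      Subgroup.map_commutator _ _ _
    rw [e]
    refine Subgroup.commutator_commutator_le_of_rotate ?_ ?_
    · refine (Subgroup.commutator_mono h0 le_rfl).trans ?_
      rw [Subgroup.commutator_le]
      rintro _ ⟨a, ha, rfl⟩ _ ⟨b, hb, rfl⟩
      rw [← map_commutatorElement, inl_mem_kernelGam]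
      have := Gam_comm_mem j 1 ha hb
      rwa [show 1 + j + 1 = j + 1 + 1 by ring] at this
    · rw [Subgroup.commutator_comm ⊤, e']
      exact Subgroup.commutator_mono ih le_rfl

/-- If `P` acts on `F` trivially on the abelianization, then the action of `Γ^{i+1}(P)` moves the
elements of `Γ^{j+1}(F)` by elements of `Γ^{i+j+2}(F)`. -/
lemma action_mul_inv_mem_Gam (hα : ∀ g a, α g a * a⁻¹ ∈ Gam F 1) {i j : ℕ} {g : P} {a : F}
    (hg : g ∈ Gam P i) (ha : a ∈ Gam F j) : α g a * a⁻¹ ∈ Gam F (i + j + 1) := by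
  -- In the semidirect product the displacement α_g(a) a⁻¹ is the commutator of g and a, so the
  -- bound on mixed commutators applies.
  have h1 := commutator_Gam_le (kernelGam α) (kernelGam_commutator_le α hα) i j
  rw [Subgroup.commutator_comm] at h1
  have h2 := h1 (Subgroup.commutator_mem_commutator
    (Gam_map (SemidirectProduct.inr : P →* F ⋊[α] P) hg) ((inl_mem_kernelGam α).2 ha))
  rw [commutatorElement_def, SemidirectProduct.conj_inl, ← map_inv, ← map_mul,
    inl_mem_kernelGam] at h2
  simpa using h2

/-- A crossed homomorphism for an action that is trivial on the abelianization preserves the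
descending central series. -/
lemma crossedHom_mem_Gam (hα : ∀ g a, α g a * a⁻¹ ∈ Gam F 1) (w : P → F)
    (hw : ∀ g h, w (g * h) = w g * α g (w h)) {i : ℕ} {g : P} (hg : g ∈ Gam P i) :
    w g ∈ Gam F i := by
  have w_one : w 1 = 1 := by
    have := hw 1 1
    rwa [mul_one, map_one, MulAut.one_apply, left_eq_mul] at this
  induction i generalizing g with
  | zero => exact Subgroup.mem_top _
  | succ i ih =>
    let N := Gam F (i + 1)
    let q : F →* F ⧸ N := QuotientGroup.mk' N
    have q_eq : ∀ a, q a = 1 ↔ a ∈ N := fun a => QuotientGroup.eq_one_iff a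
    have q_act : ∀ {k l : ℕ} {g : P} {a : F}, g ∈ Gam P k → a ∈ Gam F l → i ≤ k + l →
        q (α g a) = q a := by
      intro k l g a hg ha hkl
      rw [← mul_inv_eq_one, ← map_inv, ← map_mul, q_eq]
      exact (⊤ : Subgroup F).lowerCentralSeries_antitone (by omega)
        (action_mul_inv_mem_Gam α hα hg ha)
    -- Expand w on both sides of [g,h]·(hg) = gh. Modulo `N` the three actions that appear are
    -- trivial by the displacement estimate, and w(g) commutes with w(h) because w(g) lies in `Gam F
    -- i`; what is left is w([g,h]) = 1.
    have comm : ∀ {g}, g ∈ Gam P i → ∀ h, w ⁅g, h⁆ ∈ N := by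
      intro g hg h
      have hc : ⁅g, h⁆ ∈ Gam P i := Gam_succ_le i (Gam_comm_mem 0 i hg (Subgroup.mem_top h))
      have e : ⁅g, h⁆ * (h * g) = g * h := by rw [commutatorElement_def]; group
      have e' := congrArg q ((hw ⁅g, h⁆ (h * g)).symm.trans ((congrArg w e).trans (hw g h)))
      have c1 : q (w g) * q (w h) = q (w h) * q (w g) := by
        rw [← mul_inv_eq_one, mul_inv_rev, ← map_inv, ← map_inv, ← map_mul, ← map_mul, ← map_mul,
          q_eq]
        have := Gam_comm_mem 0 i (ih hg) (Subgroup.mem_top (w h))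
        convert this using 1
        rw [commutatorElement_def]; group
      rw [map_mul, q_act (l := 0) hc (Subgroup.mem_top _) (by omega), hw, map_mul, map_mul,
        q_act (k := 0) (Subgroup.mem_top h) (ih hg) (by omega),
        q_act (l := 0) hg (Subgroup.mem_top _) (by omega), c1, mul_eq_right, q_eq] at e'
      exact e'
    have hle : Gam P (i + 1) ≤ Gam P i := Gam_succ_le i
    have key : g ∈ Gam P (i + 1) ∧ w g ∈ N := by
      have hg' : g ∈ Subgroup.closure {g | ∃ g₁ ∈ Gam P i, ∃ g₂ ∈ (⊤ : Subgroup P),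
        ⁅g₁, g₂⁆ = g} := hg
      induction hg' using Subgroup.closure_induction with
      | mem x hx =>
        obtain ⟨a, ha, b, hb, rfl⟩ := hx
        exact ⟨Gam_comm_mem 0 i ha hb, comm ha b⟩
      | one => exact ⟨one_mem _, by rw [w_one]; exact one_mem _⟩
      | mul x y hx hy ihx ihy =>
        have ihx := ihx hx
        have ihy := ihy hy
        refine ⟨mul_mem ihx.1 ihy.1, ?_⟩
        rw [hw]
        exact mul_mem ihx.2 (Gam_map (α x).toMonoidHom ihy.2)
      | inv x hx ihx =>
        have ihx := ihx hx
        refine ⟨inv_mem ihx.1, ?_⟩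
        have := hw x⁻¹ x
        rw [inv_mul_cancel, w_one, eq_comm, mul_eq_one_iff_eq_inv] at this
        rw [this]
        exact inv_mem (Gam_map (α x⁻¹).toMonoidHom ihx.2)
    exact key.2

/-- `gr_{i+2}(G)` is spanned by the brackets of `gr_{i+1}(G)` with `gr_1(G)`. -/
lemma grBracket_span {G : Type*} [Group G] (i : ℕ) :
    Submodule.map₂ (LinearMap.mk₂ ℤ (fun a b => grBracket (G := G) i 0 a b)
      (by simp) (by simp) (by simp) (by simp)) ⊤ ⊤ = ⊤ := by
  rw [eq_top_iff]
  rintro a -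
  obtain ⟨x, hx, rfl⟩ := grCls_surj a
  set S := Submodule.map₂ (LinearMap.mk₂ ℤ (fun a b => grBracket (G := G) i 0 a b)
      (by simp) (by simp) (by simp) (by simp)) ⊤ ⊤ with hS
  have hx' : x ∈ Subgroup.closure {g | ∃ g₁ ∈ Gam G i, ∃ g₂ ∈ (⊤ : Subgroup G),
    ⁅g₁, g₂⁆ = g} := hx
  induction hx' using Subgroup.closure_induction with
  | mem x hx' =>
    obtain ⟨a, ha, b, hb, rfl⟩ := hx'
    have := Submodule.apply_mem_map₂ (LinearMap.mk₂ ℤ (fun a b => grBracket (G := G) i 0 a b)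
      (by simp) (by simp) (by simp) (by simp)) (Submodule.mem_top (x := grCls i a ha))
      (Submodule.mem_top (x := grCls 0 b hb))
    exact this
  | one => exact zero_mem S
  | mul x y hx' hy' ihx ihy => exact add_mem (ihx hx') (ihy hy')
  | inv x hx' ihx => exact neg_mem (ihx hx')

/-- The graded pieces of the descending central series of a finitely generated group are finitely
generated. -/
instance GrPiece.finite {G : Type*} [Group G] [Group.FG G] (i : ℕ) :
    Module.Finite ℤ (GrPiece G i) := by
  have h0 : Module.Finite ℤ (GrPiece G 0) := by
    rw [Module.Finite.iff_addGroup_fg]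
    have : Group.FG (Gam G 0) := (Group.fg_iff_subgroup_fg (Gam G 0)).2 Group.FG.out
    infer_instance
  induction i with
  | zero => exact h0
  | succ i ih =>
    refine ⟨?_⟩
    have := Submodule.FG.map₂ (LinearMap.mk₂ ℤ (fun a b => grBracket (G := G) i 0 a b)
      (by simp) (by simp) (by simp) (by simp)) ih.fg_top h0.fg_top
    rwa [grBracket_span] at this

/-- A surjective self-map of a finitely generated group that induces homomorphisms on the graded
pieces of the descending central series is injective on each of these. -/
lemma mem_Gam_of_surjective {G : Type*} [Group G] [Group.FG G] (v : G → G)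
    (hv : Function.Surjective v) (hΓ : ∀ {i g}, g ∈ Gam G i → v g ∈ Gam G i)
    (hmul : ∀ {i g h}, g ∈ Gam G i → h ∈ Gam G i → (v (g * h))⁻¹ * (v g * v h) ∈ Gam G (i + 1))
    {i : ℕ} {g : G} (hg : v g ∈ Gam G i) : g ∈ Gam G i := by
  induction i generalizing g with
  | zero => exact Subgroup.mem_top _
  | succ i ih =>
    let φ₀ : Gam G i →* GrQuot G i :=
      { toFun := fun x => Additive.toMul (grCls i (v x) (hΓ x.2))
        map_one' := by
          have h1 := hmul (one_mem (Gam G i)) (one_mem (Gam G i))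
          rw [mul_one, inv_mul_cancel_left] at h1
          exact congrArg Additive.toMul (grCls_eq_zero h1)
        map_mul' := fun x y => by
          change _ = Additive.toMul (grCls i (v x) (hΓ x.2) + grCls i (v y) (hΓ y.2))
          rw [← grCls_mul]
          exact congrArg Additive.toMul (grCls_eq.2 (hmul x.2 y.2)) }
    let φ : GrPiece G i →+ GrPiece G i := MonoidHom.toAdditive <| QuotientGroup.lift _ φ₀
      fun x hx => congrArg Additive.toMul (grCls_eq_zero (hΓ (Subgroup.mem_subgroupOf.1 hx)))
    have hφ : ∀ x (hx : x ∈ Gam G i), φ (grCls i x hx) = grCls i (v x) (hΓ hx) := fun _ _ => rfl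
    have surj : Function.Surjective φ.toIntLinearMap := by
      intro a
      obtain ⟨y, hy, rfl⟩ := grCls_surj a
      -- A preimage under `v` exists in G; the induction hypothesis places it in the stage `i`, so
      -- it has a class in the graded piece.
      obtain ⟨x, rfl⟩ := hv y
      exact ⟨grCls i x (ih hy), hφ _ _⟩
    have inj := IsNoetherian.injective_of_surjective_endomorphism _ surj
    have hgi := ih (Gam_succ_le i hg)
    have h0 : grCls i g hgi = grCls i 1 (one_mem _) := by
      refine inj ?_
      change φ _ = φ _
      rw [hφ, grCls_eq_zero hg]
      exact (map_zero φ).symm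
    rw [eq_comm, grCls_eq] at h0
    simpa using h0

end CrossedHom

/-! ### Artin's action on the fundamental group of a punctured sphere. -/

section ArtinAction

/-- The loop around the first `k` of `n + 1` points on the sphere. The loops for `1 ≤ k ≤ n` freely
generate the fundamental group of the complement. -/
def loopAround (n k : ℕ) : FreeGroup (Fin n) :=
  if h : 0 < k ∧ k ≤ n then FreeGroup.of ⟨k - 1, by omega⟩ else 1

variable {n : ℕ}

lemma loopAround_zero : loopAround n 0 = 1 := by simp [loopAround]

/-- For k = n + 1 this is the sphere relation: a loop around all the points is contractible. It
enters the computation of the framing of the ribbon twists. -/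
lemma loopAround_of_lt {k : ℕ} (h : n < k) : loopAround n k = 1 := by
  rw [loopAround, dif_neg (by omega)]

lemma loopAround_succ (l : Fin n) : loopAround n (l + 1) = FreeGroup.of l := by
  rw [loopAround, dif_pos (by omega)]; rfl

lemma loopAround_hom_ext {K : Type*} [Group K] {f g : FreeGroup (Fin n) →* K}
    (h : ∀ k, f (loopAround n k) = g (loopAround n k)) : f = g := by
  ext l
  rw [← loopAround_succ]
  exact h _

/-- Treats the index k uniformly, including the values 0 and k > n at which the loop is trivial, so
that later formulas need no boundary cases. -/
lemma lift_loopAround {K : Type*} [Group K] (f : Fin n → K) (g : ℕ → K) (h0 : g 0 = 1)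
    (h1 : ∀ k, n < k → g k = 1) (h : ∀ l : Fin n, f l = g (l + 1)) (k : ℕ) :
    FreeGroup.lift f (loopAround n k) = g k := by
  rcases Nat.eq_zero_or_pos k with rfl | hk
  · rw [loopAround_zero, map_one, h0]
  rcases lt_or_ge n k with hk' | hk'
  · rw [loopAround_of_lt hk', map_one, h1 k hk']
  · obtain ⟨k, rfl⟩ := Nat.exists_eq_succ_of_ne_zero hk.ne'
    have := loopAround_succ (⟨k, hk'⟩ : Fin n)
    rw [Nat.succ_eq_add_one]
    simp only at this
    rw [this, FreeGroup.lift_apply_of, h]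

/-- Artin's automorphism for the generator `σ_i`. -/
def artinHom (n i : ℕ) : FreeGroup (Fin n) →* FreeGroup (Fin n) :=
  FreeGroup.lift fun l => if (l : ℕ) = i then
    loopAround n (i + 2) * (loopAround n (i + 1))⁻¹ * loopAround n i else loopAround n (l + 1)

/-- The inverse of Artin's automorphism. -/
def artinInvHom (n i : ℕ) : FreeGroup (Fin n) →* FreeGroup (Fin n) :=
  FreeGroup.lift fun l => if (l : ℕ) = i then
    loopAround n i * (loopAround n (i + 1))⁻¹ * loopAround n (i + 2) else loopAround n (l + 1)

lemma artinHom_loopAround (i k : ℕ) : artinHom n i (loopAround n k) =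
    if k = i + 1 ∧ i < n then
      loopAround n (i + 2) * (loopAround n (i + 1))⁻¹ * loopAround n i else loopAround n k := by
  refine lift_loopAround _ (fun k => if k = i + 1 ∧ i < n then
      loopAround n (i + 2) * (loopAround n (i + 1))⁻¹ * loopAround n i else loopAround n k)
    ?_ (fun k hk => ?_) (fun l => ?_) k
  · rw [if_neg (by omega), loopAround_zero]
  · rw [if_neg (by omega), loopAround_of_lt hk]
  · have := l.2
    by_cases hl : (l : ℕ) = i
    · rw [if_pos hl, if_pos (by omega)]
    · rw [if_neg hl, if_neg (by omega)]

lemma artinInvHom_loopAround (i k : ℕ) : artinInvHom n i (loopAround n k) =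
    if k = i + 1 ∧ i < n then
      loopAround n i * (loopAround n (i + 1))⁻¹ * loopAround n (i + 2) else loopAround n k := by
  refine lift_loopAround _ (fun k => if k = i + 1 ∧ i < n then
      loopAround n i * (loopAround n (i + 1))⁻¹ * loopAround n (i + 2) else loopAround n k)
    ?_ (fun k hk => ?_) (fun l => ?_) k
  · rw [if_neg (by omega), loopAround_zero]
  · rw [if_neg (by omega), loopAround_of_lt hk]
  · have := l.2
    by_cases hl : (l : ℕ) = i
    · rw [if_pos hl, if_pos (by omega)]
    · rw [if_neg hl, if_neg (by omega)]

/-- Artin's automorphism `σ_i : E_{i+1} ↦ E_{i+2} E_{i+1}⁻¹ E_i`. -/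
def artinAut (n i : ℕ) : MulAut (FreeGroup (Fin n)) :=
  MonoidHom.toMulEquiv (artinHom n i) (artinInvHom n i)
    (loopAround_hom_ext fun k => by
      rw [MonoidHom.comp_apply, artinHom_loopAround]
      split_ifs with h
      · simp [artinInvHom_loopAround, h]
      · rw [artinInvHom_loopAround, if_neg h]; rfl)
    (loopAround_hom_ext fun k => by
      rw [MonoidHom.comp_apply, artinInvHom_loopAround]
      split_ifs with h
      · simp [artinHom_loopAround, h]
      · rw [artinHom_loopAround, if_neg h]; rfl)

lemma artinAut_loopAround_self {i : ℕ} (h : i < n) : artinAut n i (loopAround n (i + 1)) =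
    loopAround n (i + 2) * (loopAround n (i + 1))⁻¹ * loopAround n i :=
  (artinHom_loopAround i _).trans (if_pos ⟨rfl, h⟩)

lemma artinAut_loopAround_of_ne {i k : ℕ} (h : k ≠ i + 1) :
    artinAut n i (loopAround n k) = loopAround n k :=
  (artinHom_loopAround i _).trans (if_neg (by omega))

lemma loopAround_aut_ext {f g : MulAut (FreeGroup (Fin n))}
    (h : ∀ k, f (loopAround n k) = g (loopAround n k)) : f = g :=
  MulEquiv.ext fun a => DFunLike.congr_fun (loopAround_hom_ext (f := f.toMonoidHom)
    (g := g.toMonoidHom) h) a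

lemma artinAut_comm {i j : ℕ} (hij : i + 2 ≤ j) (hj : j + 1 < n + 1) :
    artinAut n i * artinAut n j = artinAut n j * artinAut n i := by
  refine loopAround_aut_ext fun k => ?_
  rw [MulAut.mul_apply, MulAut.mul_apply]
  by_cases hi : k = i + 1
  · subst hi
    rw [artinAut_loopAround_of_ne (i := j) (by omega), artinAut_loopAround_self (by omega), map_mul,
      map_mul, map_inv]
    iterate 3 rw [artinAut_loopAround_of_ne (by omega)]
  · rw [artinAut_loopAround_of_ne (i := i) hi]
    by_cases hk : k = j + 1
    · subst hk
      rw [artinAut_loopAround_self (by omega), map_mul, map_mul, map_inv]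
      iterate 3 rw [artinAut_loopAround_of_ne (by omega)]
    · rw [artinAut_loopAround_of_ne hk, artinAut_loopAround_of_ne hi]

lemma artinAut_braid {i : ℕ} (hi : i + 2 < n + 1) :
    artinAut n i * artinAut n (i + 1) * artinAut n i =
      artinAut n (i + 1) * artinAut n i * artinAut n (i + 1) := by
  refine loopAround_aut_ext fun k => ?_
  have a0 : artinAut n i (loopAround n i) = loopAround n i :=
    artinAut_loopAround_of_ne (by omega)
  have a1 := artinAut_loopAround_self (n := n) (i := i) (by omega)
  have a2 : artinAut n i (loopAround n (i + 2)) = loopAround n (i + 2) :=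
    artinAut_loopAround_of_ne (by omega)
  have a3 : artinAut n i (loopAround n (i + 3)) = loopAround n (i + 3) :=
    artinAut_loopAround_of_ne (by omega)
  have b0 : artinAut n (i + 1) (loopAround n i) = loopAround n i :=
    artinAut_loopAround_of_ne (by omega)
  have b1 : artinAut n (i + 1) (loopAround n (i + 1)) = loopAround n (i + 1) :=
    artinAut_loopAround_of_ne (by omega)
  have b2 : artinAut n (i + 1) (loopAround n (i + 2)) =
      loopAround n (i + 3) * (loopAround n (i + 2))⁻¹ * loopAround n (i + 1) :=
    artinAut_loopAround_self (by omega)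
  have b3 : artinAut n (i + 1) (loopAround n (i + 3)) = loopAround n (i + 3) :=
    artinAut_loopAround_of_ne (by omega)
  simp only [MulAut.mul_apply]
  by_cases h1 : k = i + 1
  · subst h1
    simp only [a0, a1, a2, a3, b0, b1, b2, map_mul, map_inv]
    group
  by_cases h2 : k = i + 2
  · subst h2
    simp only [a1, a2, a3, b0, b1, b2, b3, map_mul, map_inv]
    group
  simp only [artinAut_loopAround_of_ne (n := n) h1,
    artinAut_loopAround_of_ne (n := n) (i := i + 1) (k := k) (by omega)]

/-- Artin's action of `B_{n+1}` on the fundamental group of the sphere without `n + 1` points. -/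
def artinAct (n : ℕ) : BraidGroup (n + 1) →* MulAut (FreeGroup (Fin n)) :=
  braidLift (artinAut n) (fun _ _ => artinAut_comm) fun _ => artinAut_braid

lemma artinAct_gen {i : ℕ} (h : i < n) : artinAct n (braidGen (n + 1) i) = artinAut n i :=
  braidLift_gen _ _ _ (by omega)

/-! ### Framings: a consistent choice of conjugators for Artin's action. -/

/-- The loop around the `j`-th point. -/
def loopAt (n j : ℕ) : FreeGroup (Fin n) := (loopAround n j)⁻¹ * loopAround n (j + 1)

/-- The conjugator of the loop around the `j`-th point under Artin's automorphism. -/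
def genFrame (n i j : ℕ) : FreeGroup (Fin n) := if j = i then loopAt n i else 1

/-- The action of `σ_i` on framed points: the `j`-th point together with an element of the
fundamental group. -/
def framedGen (n i : ℕ) : Equiv.Perm (ℕ × FreeGroup (Fin n)) where
  toFun x := (Equiv.swap i (i + 1) x.1, artinAut n i x.2 * genFrame n i x.1)
  invFun x := (Equiv.swap i (i + 1) x.1,
    (artinAut n i).symm (x.2 * (genFrame n i (Equiv.swap i (i + 1) x.1))⁻¹))
  left_inv x := by simp
  right_inv x := by simp

lemma framedGen_apply (i j : ℕ) (g : FreeGroup (Fin n)) : framedGen n i (j, g) =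
    (Equiv.swap i (i + 1) j, artinAut n i g * genFrame n i j) := rfl

lemma artinAut_loopAt_of_ne {i j : ℕ} (h : j ≠ i) (h' : j ≠ i + 1) :
    artinAut n i (loopAt n j) = loopAt n j := by
  rw [loopAt, map_mul, map_inv, artinAut_loopAround_of_ne (by omega),
    artinAut_loopAround_of_ne (by omega)]

lemma artinAut_loopAt_succ {i : ℕ} (h : i < n) :
    artinAut n i (loopAt n (i + 1)) = loopAt n i := by
  rw [loopAt, map_mul, map_inv, artinAut_loopAround_self h, artinAut_loopAround_of_ne (by omega),
    loopAt]
  group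

lemma artinAut_loopAt_self {i : ℕ} (h : i < n) :
    artinAut n i (loopAt n i) = loopAt n i * loopAt n (i + 1) * (loopAt n i)⁻¹ := by
  rw [loopAt, map_mul, map_inv, artinAut_loopAround_self h, artinAut_loopAround_of_ne (by omega),
    loopAt]
  group

lemma framedGen_comm {i j : ℕ} (hij : i + 2 ≤ j) (hj : j + 1 < n + 1) :
    framedGen n i * framedGen n j = framedGen n j * framedGen n i := by
  refine Equiv.ext fun ⟨k, g⟩ => ?_
  simp only [Equiv.Perm.mul_apply, framedGen_apply, map_mul]
  have hg := DFunLike.congr_fun (artinAut_comm hij hj) g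
  rw [MulAut.mul_apply, MulAut.mul_apply] at hg
  refine Prod.ext ?_ ?_
  · simp only [Equiv.swap_apply_def]
    split_ifs <;> omega
  · simp only [hg, mul_assoc]
    congr 1
    by_cases h1 : k = i
    · subst h1
      rw [Equiv.swap_apply_of_ne_of_ne (by omega) (by omega)]
      simp only [genFrame, if_neg (show k ≠ j by omega), if_true, Equiv.swap_apply_left,
        if_neg (show k + 1 ≠ j by omega), map_one, one_mul, mul_one]
      rw [artinAut_loopAt_of_ne (by omega) (by omega)]
    by_cases h2 : k = j
    · subst h2
      rw [Equiv.swap_apply_of_ne_of_ne (a := i) (by omega) (by omega)]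
      simp only [genFrame, if_neg h1, if_true, Equiv.swap_apply_left,
        if_neg (show k + 1 ≠ i by omega), map_one, one_mul, mul_one]
      rw [artinAut_loopAt_of_ne (by omega) (by omega)]
    have h3 : Equiv.swap j (j + 1) k ≠ i := by
      rw [Equiv.swap_apply_def]; split_ifs <;> omega
    have h4 : Equiv.swap i (i + 1) k ≠ j := by
      rw [Equiv.swap_apply_def]; split_ifs <;> omega
    simp [genFrame, h1, h2, h3, h4]

/-- An automorphism determines the conjugators only up to centralizers of the loops, so this
relation does not follow from `artinAut_braid` and is checked on the chosen conjugators. It makes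
the framing a function of the braid. -/
lemma framedGen_braid {i : ℕ} (hi : i + 2 < n + 1) :
    framedGen n i * framedGen n (i + 1) * framedGen n i =
      framedGen n (i + 1) * framedGen n i * framedGen n (i + 1) := by
  refine Equiv.ext fun ⟨k, g⟩ => ?_
  simp only [Equiv.Perm.mul_apply, framedGen_apply, map_mul]
  have hg := DFunLike.congr_fun (artinAut_braid hi) g
  simp only [MulAut.mul_apply] at hg
  have s1 : Equiv.swap (i + 1) (i + 1 + 1) i = i :=
    Equiv.swap_apply_of_ne_of_ne (by omega) (by omega)
  have s2 : Equiv.swap i (i + 1) (i + 1 + 1) = i + 1 + 1 :=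
    Equiv.swap_apply_of_ne_of_ne (by omega) (by omega)
  refine Prod.ext ?_ ?_
  · simp only [Equiv.swap_apply_def]
    split_ifs <;> omega
  · simp only [hg, mul_assoc]
    congr 1
    have a1 := artinAut_loopAt_succ (n := n) (i := i) (by omega)
    have a2 : artinAut n (i + 1) (loopAt n i) = loopAt n i :=
      artinAut_loopAt_of_ne (by omega) (by omega)
    have a3 := artinAut_loopAt_self (n := n) (i := i) (by omega)
    by_cases h1 : k = i
    · subst h1
      simp only [genFrame, s1, Equiv.swap_apply_left, if_true, if_neg (show k ≠ k + 1 by omega),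
        if_neg (show k + 1 + 1 ≠ k by omega), map_one, one_mul, mul_one, a1, a2, a3]
      group
    by_cases h2 : k = i + 1
    · subst h2
      simp only [genFrame, s1, s2, Equiv.swap_apply_left, Equiv.swap_apply_right, if_true,
        if_neg (show i ≠ i + 1 by omega), if_neg (show i + 1 ≠ i by omega),
        if_neg (show i + 1 + 1 ≠ i + 1 by omega), if_neg (show i + 1 + 1 ≠ i by omega), map_one,
        one_mul, mul_one, a1, a2]
    by_cases h3 : k = i + 2
    · subst h3
      simp only [genFrame, s2, Equiv.swap_apply_right, if_neg (show i ≠ i + 1 by omega),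
        if_neg (show i + 1 ≠ i by omega), if_neg (show i + 1 + 1 ≠ i + 1 by omega),
        if_neg (show i + 1 + 1 ≠ i by omega), map_one, mul_one]
    have s3 : Equiv.swap i (i + 1) k = k := Equiv.swap_apply_of_ne_of_ne (by omega) (by omega)
    have s4 : Equiv.swap (i + 1) (i + 1 + 1) k = k :=
      Equiv.swap_apply_of_ne_of_ne (by omega) (by omega)
    simp [genFrame, s3, s4, h1, h2]

/-- The action of `B_{n+1}` on framed points. -/
def framedAct (n : ℕ) : BraidGroup (n + 1) →* Equiv.Perm (ℕ × FreeGroup (Fin n)) :=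
  braidLift (framedGen n) (fun _ _ => framedGen_comm) fun _ => framedGen_braid

/-- The conjugator of the loop around the `j`-th point under the action of a braid. -/
def frame (b : BraidGroup (n + 1)) (j : ℕ) : FreeGroup (Fin n) := (framedAct n b (j, 1)).2

lemma framedAct_apply (b : BraidGroup (n + 1)) (j : ℕ) (g : FreeGroup (Fin n)) :
    framedAct n b (j, g) = (braidPerm (n + 1) b j, artinAct n b g * frame b j) := by
  unfold frame
  induction b using BraidGroup.induction generalizing j g with
  | one => simp
  | gen i hi =>
    rw [framedAct, braidLift_gen _ _ _ hi, framedGen_apply, framedGen_apply, map_one, one_mul,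
      artinAct_gen (by omega), braidPerm_gen hi]
  | mul a b ha hb =>
    rw [map_mul, Equiv.Perm.mul_apply, Equiv.Perm.mul_apply, hb, hb _ 1, ha, ha _ (_ * _), map_one,
      one_mul, map_mul, map_mul, map_mul, MulAut.mul_apply, Equiv.Perm.mul_apply, mul_assoc]
  | inv b hb =>
    rw [map_inv, Equiv.Perm.inv_eq_iff_eq, hb]
    have e : framedAct n b ((framedAct n b)⁻¹ (j, 1)) = (j, 1) :=
      Equiv.apply_symm_apply (framedAct n b) _
    -- The induction hypothesis at the preimage (j', g') of (j, 1) gives j' as the inverse image of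
    -- j and identifies b(g') as the inverse of the frame of b at j'.
    have e1 := hb ((framedAct n b)⁻¹ (j, 1)).1 ((framedAct n b)⁻¹ (j, 1)).2
    rw [Prod.mk.eta, e, Prod.mk.injEq] at e1
    refine Prod.ext ?_ ?_
    · rw [map_inv]; exact (Equiv.apply_symm_apply (braidPerm (n + 1) b) j).symm
    · have e2 : ((braidPerm (n + 1) b)⁻¹ j) = ((framedAct n b)⁻¹ (j, 1)).1 := by
        rw [Equiv.Perm.inv_eq_iff_eq]; exact e1.1
      simp only [map_inv, map_mul]
      rw [e2, mul_assoc, ← e1.2, mul_one]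
      exact (MulAut.apply_inv_self _ (artinAct n b) g).symm

lemma frame_one (j : ℕ) : frame (1 : BraidGroup (n + 1)) j = 1 := by simp [frame]

lemma frame_mul (a b : BraidGroup (n + 1)) (j : ℕ) :
    frame (a * b) j = artinAct n a (frame b j) * frame a (braidPerm (n + 1) b j) := by
  rw [frame, map_mul, Equiv.Perm.mul_apply, framedAct_apply b, framedAct_apply, map_one, one_mul]

lemma frame_gen {i : ℕ} (h : i < n) (j : ℕ) :
    frame (braidGen (n + 1) i) j = genFrame n i j := by
  rw [frame, framedAct, braidLift_gen _ _ _ (by omega), framedGen_apply, map_one, one_mul]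

/-- Confirms that frames really are conjugators: both sides obey the cocycle rule `frame_mul`, so
the Artin generators suffice. -/
lemma artinAct_loopAt (b : BraidGroup (n + 1)) (j : ℕ) : artinAct n b (loopAt n j) =
    frame b j * loopAt n (braidPerm (n + 1) b j) * (frame b j)⁻¹ := by
  induction b using BraidGroup.induction generalizing j with
  | one => simp [frame_one]
  | gen i hi =>
    rw [artinAct_gen (by omega), frame_gen (by omega), braidPerm_gen hi, genFrame]
    split_ifs with h
    · subst h
      rw [Equiv.swap_apply_left, artinAut_loopAt_self (by omega)]
    · by_cases h' : j = i + 1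
      · subst h'
        rw [Equiv.swap_apply_right, artinAut_loopAt_succ (by omega)]; group
      · rw [Equiv.swap_apply_of_ne_of_ne h h', artinAut_loopAt_of_ne h h']; group
  | mul a b ha hb =>
    rw [map_mul, MulAut.mul_apply, hb, map_mul, map_mul, map_inv, ha, frame_mul, map_mul,
      Equiv.Perm.mul_apply]
    group
  | inv b hb =>
    obtain ⟨j, rfl⟩ := (braidPerm (n + 1) b).surjective j
    have h1 := frame_mul b⁻¹ b j
    rw [inv_mul_cancel, frame_one, eq_comm, mul_eq_one_iff_inv_eq] at h1
    have h2 := congrArg (artinAct n b⁻¹) (hb j)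
    rw [← MulAut.mul_apply, ← map_mul, inv_mul_cancel, map_one, MulAut.one_apply, map_mul, map_mul,
      map_inv] at h2
    rw [← h1, map_inv (braidPerm (n + 1)), Equiv.Perm.inv_eq_iff_eq.2 rfl, h2]
    simp only [map_inv]
    group

/-- The action of a braid on the loop around a block of points that it carries along in parallel. -/
lemma artinAct_block (b : BraidGroup (n + 1)) {c d r : ℕ} {u : FreeGroup (Fin n)}
    (hf : ∀ i < r, frame b (c + i) = u)
    (hp : ∀ i < r, braidPerm (n + 1) b (c + i) = d + i) :
    artinAct n b ((loopAround n c)⁻¹ * loopAround n (c + r)) =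
      u * ((loopAround n d)⁻¹ * loopAround n (d + r)) * u⁻¹ := by
  induction r with
  | zero => simp
  | succ r ih =>
    have ih := ih (fun i hi => hf i (by omega)) (fun i hi => hp i (by omega))
    have e : ∀ c, (loopAround n c)⁻¹ * loopAround n (c + (r + 1)) =
        (loopAround n c)⁻¹ * loopAround n (c + r) * loopAt n (c + r) := by
      intro c; rw [loopAt, ← add_assoc]; group
    rw [e, map_mul, ih, artinAct_loopAt, hf r (by omega), hp r (by omega), e]
    group

lemma braidPerm_strandCross_self {a q : ℕ} (h : a + q ≤ n) :
    braidPerm (n + 1) (strandCross (n + 1) a q) a = a + q := by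
  induction q with
  | zero => simp [strandCross]
  | succ q ih =>
    rw [strandCross, map_mul, Equiv.Perm.mul_apply, ih (by omega), braidPerm_gen (by omega),
      Equiv.swap_apply_left, add_assoc]

lemma braidPerm_strandCross_lt {a q j : ℕ} (h : a + q ≤ n) (hj : j < a) :
    braidPerm (n + 1) (strandCross (n + 1) a q) j = j := by
  induction q with
  | zero => simp [strandCross]
  | succ q ih =>
    rw [strandCross, map_mul, Equiv.Perm.mul_apply, ih (by omega), braidPerm_gen (by omega),
      Equiv.swap_apply_of_ne_of_ne (by omega) (by omega)]

lemma frame_strandCross {a q : ℕ} (h : a + q ≤ n) (j : ℕ) :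
    frame (strandCross (n + 1) a q) j =
      if j = a then (loopAround n a)⁻¹ * loopAround n (a + q) else 1 := by
  induction q with
  | zero => simp [strandCross, frame_one]
  | succ q ih =>
    rw [strandCross, frame_mul, ih (by omega), frame_gen (by omega), artinAct_gen (by omega),
      genFrame]
    split_ifs with h1 h2 h2
    · rw [map_mul, map_inv, artinAut_loopAround_of_ne (by omega),
        artinAut_loopAround_of_ne (by omega), loopAt, ← add_assoc]
      group
    · subst h1
      exact absurd (braidPerm_strandCross_self (by omega)) h2
    · rw [← braidPerm_strandCross_self (n := n) (a := a) (q := q) (by omega)] at h2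
      exact absurd ((braidPerm (n + 1) _).injective h2) h1
    · rw [map_one, one_mul]

lemma braidPerm_blockCross_left {a p q i : ℕ} (h : a + p + q ≤ n + 1) (hi : i < p) :
    braidPerm (n + 1) (blockCross (n + 1) a p q) (a + i) = a + q + i := by
  have := braidPerm_blockCross h id (a + q + i)
  simp only [id, blockSwap] at this
  rw [if_neg (by omega), if_neg (by omega), if_pos (by omega), Equiv.Perm.inv_eq_iff_eq] at this
  rw [this]
  congr 1
  omega

lemma braidPerm_blockCross_right {a p q i : ℕ} (h : a + p + q ≤ n + 1) (hi : i < q) :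
    braidPerm (n + 1) (blockCross (n + 1) a p q) (a + p + i) = a + i := by
  have := braidPerm_blockCross h id (a + i)
  simp only [id, blockSwap] at this
  rw [if_neg (by omega), if_pos (by omega), Equiv.Perm.inv_eq_iff_eq] at this
  rw [this]
  congr 1
  omega

/-- Only the strands of the first block are conjugated, and all by the loop around the q positions
that the second block occupies after the crossing. The common value across the block is what makes
`artinAct_block` applicable. -/
lemma frame_blockCross {a p q : ℕ} (h : a + p + q ≤ n + 1) (j : ℕ) :
    frame (blockCross (n + 1) a p q) j =
      if a ≤ j ∧ j < a + p then (loopAround n a)⁻¹ * loopAround n (a + q) else 1 := by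
  induction p generalizing j with
  | zero => rw [blockCross, frame_one, if_neg (by omega)]
  | succ p ih =>
    have ih := ih (by omega)
    rw [blockCross, frame_mul, frame_strandCross (by omega), ih]
    have hlt : ∀ j < a + p, braidPerm (n + 1) (strandCross (n + 1) (a + p) q) j = j := fun j hj =>
      braidPerm_strandCross_lt (by omega) hj
    have hge : a + p ≤ j → a + p ≤ braidPerm (n + 1) (strandCross (n + 1) (a + p) q) j := by
      intro hj
      by_contra hlt'
      have := (braidPerm (n + 1) _).injective (hlt _ (not_le.1 hlt'))
      omega
    by_cases h1 : j = a + p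
    · have h2 := hge (by omega)
      rw [if_pos h1, if_neg (by omega), if_pos (by omega), mul_one,
        -- The last strand of the block circles the q positions starting at a + p; the remaining
        -- block crossing carries these, with trivial frame, to the q positions starting at a.
        artinAct_block (blockCross (n + 1) a p q) (d := a) (u := 1) (fun i hi => ?_)
          fun i hi => braidPerm_blockCross_right (by omega) hi]
      · group
      · rw [ih, if_neg (by omega)]
    · rw [if_neg h1, map_one, one_mul]
      rcases lt_or_ge j (a + p) with h2 | h2
      · rw [hlt j h2]
        exact if_congr (by omega) rfl rfl
      · have h3 := hge h2
        rw [if_neg (by omega), if_neg (by omega)]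

/-! ### Ribbon twists: their frames and their action. -/

/-- The full twist of the first `p` strands and the remaining ones, as two ribbons. -/
def ribbonTwist (n p : ℕ) : BraidGroup (n + 1) :=
  blockCross (n + 1) 0 (n + 1 - p) p * blockCross (n + 1) 0 p (n + 1 - p)

lemma cabledTwist_eq_ribbonTwist (n : ℕ) (q : Fin n) :
    (cabledTwist n q : BraidGroup (n + 1)) = ribbonTwist n (n - q) := by
  rw [cabledTwist_val, ribbonTwist, show n + 1 - (n - (q : ℕ)) = q + 1 by omega]

/-- Each ribbon goes once around the other one. The loop around the second ribbon is the inverse of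
that around the first, because the two together enclose all the points of the sphere. -/
lemma frame_ribbonTwist {p j : ℕ} (hp : p ≤ n + 1) (hj : j < n + 1) :
    frame (ribbonTwist n p) j = if j < p then (loopAround n p)⁻¹ else loopAround n p := by
  have e1 := frame_blockCross (n := n) (a := 0) (p := p) (q := n + 1 - p) (by omega) j
  rw [ribbonTwist, frame_mul, e1, frame_blockCross (by omega)]
  simp only [zero_add, Nat.zero_le, true_and, loopAround_zero, inv_one, one_mul]
  split_ifs with h1 h2 h2
  · have := braidPerm_blockCross_left (n := n) (a := 0) (q := n + 1 - p) (by omega) h1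
    rw [zero_add, zero_add] at this
    omega
  · have := artinAct_block (blockCross (n + 1) 0 (n + 1 - p) p) (c := 0) (r := n + 1 - p)
      (d := p) (u := loopAround n p) (fun i hi => ?_) fun i hi => ?_
    · rw [loopAround_zero, inv_one, one_mul, zero_add] at this
      -- The sphere relation E_{n+1} = 1 turns E_p (E_p⁻¹ E_{n+1}) E_p⁻¹ into E_p⁻¹.
      rw [this, loopAround_of_lt (k := p + (n + 1 - p)) (by omega)]
      group
    · rw [frame_blockCross (by omega), if_pos (by omega), loopAround_zero]
      simp
    · rw [braidPerm_blockCross_left (by omega) hi, zero_add]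
  · rw [map_one, one_mul]
  · have := braidPerm_blockCross_right (n := n) (a := 0) (p := p) (q := n + 1 - p) (i := j - p)
      (by omega) (by omega)
    rw [zero_add, zero_add, show p + (j - p) = j by omega] at this
    omega

lemma braidPerm_ribbonTwist {p : ℕ} (hp : p ≤ n + 1) {j : ℕ} (hj : j < n + 1) :
    braidPerm (n + 1) (ribbonTwist n p) j = j := by
  rw [ribbonTwist, map_mul, Equiv.Perm.mul_apply]
  rcases lt_or_ge j p with h | h
  · have h1 := braidPerm_blockCross_left (n := n) (a := 0) (q := n + 1 - p) (by omega) h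
    have h2 := braidPerm_blockCross_right (n := n) (a := 0) (p := n + 1 - p) (by omega) h
    simp only [zero_add] at h1 h2
    rw [h1, h2]
  · have h1 := braidPerm_blockCross_right (n := n) (a := 0) (p := p) (q := n + 1 - p) (i := j - p)
      (by omega) (by omega)
    have h2 := braidPerm_blockCross_left (n := n) (a := 0) (p := n + 1 - p) (q := p) (i := j - p)
      (by omega) (by omega)
    simp only [zero_add] at h1 h2
    rw [show p + (j - p) = j by omega] at h1 h2
    rw [h1, h2]

/-- Artin's action of the ribbon twists. -/
theorem isTwistFamily_ribbonTwist (n : ℕ) : IsTwistFamily (fun k => loopAround n (k + 1))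
    (fun k => artinAct n (ribbonTwist n (k + 1))) n := by
  have first : ∀ p l, l ≤ p → p ≤ n + 1 → artinAct n (ribbonTwist n p) (loopAround n l) =
      (loopAround n p)⁻¹ * loopAround n l * loopAround n p := by
    intro p l hl hp
    have := artinAct_block (ribbonTwist n p) (c := 0) (d := 0) (r := l) (u := (loopAround n p)⁻¹)
      (fun i hi => by rw [frame_ribbonTwist hp (by omega), if_pos (by omega)])
      fun i hi => braidPerm_ribbonTwist hp (by omega)
    simpa [loopAround_zero] using this
  refine ⟨fun k l hl hk => first _ _ (by omega) (by omega), fun k l hl hk => ?_⟩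
  -- For a loop that reaches into the second ribbon, write E_{l+1} = E_{k+1} · (E_{k+1}⁻¹ E_{l+1}).
  -- The first factor is fixed by the twist, and the second surrounds strands of the second ribbon
  -- only, so it is conjugated by E_{k+1}.
  have := artinAct_block (ribbonTwist n (k + 1)) (c := k + 1) (d := k + 1) (r := l - k)
      (u := loopAround n (k + 1))
      (fun i hi => by rw [frame_ribbonTwist (by omega) (by omega), if_neg (by omega)])
      fun i hi => braidPerm_ribbonTwist (by omega) (by omega)
  rw [show k + 1 + (l - k) = l + 1 by omega, map_mul, map_inv, first _ _ le_rfl (by omega)] at this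
  have h2 := congrArg (loopAround n (k + 1) * ·) this
  convert h2 using 1 <;> group

lemma closure_loopAround (n : ℕ) :
    initialSubgroup (fun k => loopAround n (k + 1)) n = ⊤ := by
  rw [eq_top_iff, ← FreeGroup.closure_range_of]
  refine Subgroup.closure_mono ?_
  rintro _ ⟨l, rfl⟩
  exact ⟨l, l.2, loopAround_succ l⟩

/-- Pure braids act trivially on the abelianization. -/
lemma artinAct_pure {b : BraidGroup (n + 1)} (hb : b ∈ PureBraid (n + 1))
    (a : FreeGroup (Fin n)) : artinAct n b a * a⁻¹ ∈ Gam (FreeGroup (Fin n)) 1 := by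
  let q := QuotientGroup.mk' (Gam (FreeGroup (Fin n)) 1)
  have q_eq : ∀ a, q a = 1 ↔ a ∈ Gam (FreeGroup (Fin n)) 1 := fun a => QuotientGroup.eq_one_iff a
  -- A pure braid sends the loop around each point to a conjugate of itself.
  have hat : ∀ j, q (artinAct n b (loopAt n j)) = q (loopAt n j) := by
    intro j
    rw [← mul_inv_eq_one, ← map_inv, ← map_mul, q_eq, artinAct_loopAt, MonoidHom.mem_ker.1 hb]
    exact Gam_comm_mem 0 0 (Subgroup.mem_top _) (Subgroup.mem_top _)
  have haround : ∀ k, q (artinAct n b (loopAround n k)) = q (loopAround n k) := by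
    intro k
    induction k with
    | zero => rw [loopAround_zero, map_one]
    | succ k ih =>
      have e : loopAround n (k + 1) = loopAround n k * loopAt n k := by rw [loopAt]; group
      rw [e, map_mul, map_mul, map_mul, ih, hat]
  have key : q.comp (artinAct n b).toMonoidHom = q := loopAround_hom_ext haround
  rw [← q_eq, map_mul, map_inv, mul_inv_eq_one]
  exact DFunLike.congr_fun key a

end ArtinAction

/-! ### Residual nilpotence of free groups by a Magnus expansion with square-zero variables. -/

section ResiduallyNilpotent

variable {α : Type*}

/-- The operators that raise the order of power series by `i`. -/
def RaisesOrder (i : ℕ) (T : Module.End ℤ (List α → ℤ)) : Prop :=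
  ∀ d (f : List α → ℤ), (∀ l, l.length < d → f l = 0) → ∀ l, l.length < d + i → T f l = 0

lemma RaisesOrder.mul {i j : ℕ} {S T : Module.End ℤ (List α → ℤ)} (hS : RaisesOrder i S)
    (hT : RaisesOrder j T) : RaisesOrder (i + j) (S * T) := by
  intro d f hf l hl
  exact hS (d + j) (T f) (hT d f hf) l (by omega)

lemma RaisesOrder.add {i : ℕ} {S T : Module.End ℤ (List α → ℤ)} (hS : RaisesOrder i S)
    (hT : RaisesOrder i T) : RaisesOrder i (S + T) := by
  intro d f hf l hl
  rw [LinearMap.add_apply, Pi.add_apply, hS d f hf l hl, hT d f hf l hl, add_zero]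

lemma RaisesOrder.neg {i : ℕ} {S : Module.End ℤ (List α → ℤ)} (hS : RaisesOrder i S) :
    RaisesOrder i (-S) := by
  intro d f hf l hl
  rw [LinearMap.neg_apply, Pi.neg_apply, hS d f hf l hl, neg_zero]

lemma RaisesOrder.mono {i j : ℕ} (h : i ≤ j) {S : Module.End ℤ (List α → ℤ)}
    (hS : RaisesOrder j S) : RaisesOrder i S :=
  fun d f hf l hl => hS d f hf l (by omega)

lemma raisesOrder_one : RaisesOrder 0 (1 : Module.End ℤ (List α → ℤ)) := fun _ _ hf => hf

variable [DecidableEq α]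

/-- Multiplication by the variable `x` in the ring of formal power series in noncommuting variables
of square zero, given by their coefficients at the words without repetitions. -/
def mulVar (x : α) : Module.End ℤ (List α → ℤ) where
  toFun f
    | [] => 0
    | y :: t => if y = x ∧ t.head? ≠ some x then f t else 0
  map_add' f g := by
    funext l
    rcases l with _ | ⟨y, t⟩
    · simp
    · simp only [Pi.add_apply]; split_ifs <;> simp
  map_smul' c f := by
    funext l
    rcases l with _ | ⟨y, t⟩
    · simp
    · simp only [Pi.smul_apply]; split_ifs <;> simp

lemma mulVar_nil (x : α) (f : List α → ℤ) : mulVar x f [] = 0 := rfl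

lemma mulVar_cons (x y : α) (f : List α → ℤ) (t : List α) :
    mulVar x f (y :: t) = if y = x ∧ t.head? ≠ some x then f t else 0 := rfl

/-- A nonzero coefficient after two multiplications would need a word beginning with `x` twice,
which the test on the head of the tail excludes. It follows that (1 + x)^k = 1 + kx for every
integer k. -/
lemma mulVar_mul_self (x : α) : mulVar x * mulVar x = 0 := by
  refine LinearMap.ext fun f => funext fun l => ?_
  rw [Module.End.mul_apply]
  rcases l with _ | ⟨y, _ | ⟨z, t⟩⟩
  · rfl
  · simp [mulVar_cons, mulVar_nil]
  · rw [mulVar_cons, mulVar_cons]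
    split_ifs with h h' <;> simp_all

/-- The unit `1 + x`, with inverse `1 - x`. -/
def oneAddVar (x : α) : (Module.End ℤ (List α → ℤ))ˣ where
  val := 1 + mulVar x
  inv := 1 - mulVar x
  val_inv := by rw [mul_sub, mul_one, add_mul, mulVar_mul_self]; simp
  inv_val := by rw [mul_add, mul_one, sub_mul, mulVar_mul_self]; simp

lemma oneAddVar_zpow (x : α) (k : ℤ) :
    ((oneAddVar x ^ k : (Module.End ℤ (List α → ℤ))ˣ) : Module.End ℤ (List α → ℤ)) =
      1 + k • mulVar x := by
  have e : ((oneAddVar x : (Module.End ℤ (List α → ℤ))ˣ) : Module.End ℤ (List α → ℤ)) =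
    1 + mulVar x := rfl
  have e' : ((oneAddVar x)⁻¹ : (Module.End ℤ (List α → ℤ))ˣ).val = 1 - mulVar x := rfl
  induction k using Int.induction_on with
  | zero => simp
  | succ k ih =>
    rw [zpow_add_one, Units.val_mul, ih, e, add_mul, mul_add, smul_mul_assoc, mul_add,
      mulVar_mul_self, add_smul]
    simp only [one_mul, mul_one, one_smul, add_zero]
    abel
  | pred k ih =>
    rw [zpow_sub_one, Units.val_mul, ih, e', add_mul, mul_sub, smul_mul_assoc, mul_sub,
      mulVar_mul_self, sub_smul]
    simp only [one_mul, mul_one, one_smul, sub_zero]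
    abel

/-- The Magnus representation of a free group. -/
def magnus (α : Type*) [DecidableEq α] : FreeGroup α →* (Module.End ℤ (List α → ℤ))ˣ :=
  FreeGroup.lift oneAddVar

lemma raisesOrder_mulVar (x : α) : RaisesOrder 1 (mulVar x) := by
  rintro d f hf (_ | ⟨y, t⟩) hl
  · rfl
  · rw [mulVar_cons]
    split_ifs
    · exact hf t (by simpa using hl)
    · rfl

lemma raisesOrder_magnus (g : FreeGroup α) : RaisesOrder 0 (magnus α g).val := by
  induction g using FreeGroup.induction_on with
  | C1 => rw [map_one]; exact raisesOrder_one
  | of x =>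
    rw [magnus, FreeGroup.lift_apply_of]
    exact raisesOrder_one.add ((raisesOrder_mulVar x).mono (Nat.zero_le 1))
  | inv_of x _ =>
    rw [magnus, map_inv, FreeGroup.lift_apply_of]
    change RaisesOrder 0 (1 - mulVar x)
    rw [sub_eq_add_neg]
    exact raisesOrder_one.add ((raisesOrder_mulVar x).mono (Nat.zero_le 1)).neg
  | mul a b ha hb => rw [map_mul, Units.val_mul]; exact ha.mul hb

/-- The elements whose Magnus operator differs from `1` by an operator that raises the order by
`i`. -/
def magnusSubgroup (α : Type*) [DecidableEq α] (i : ℕ) : Subgroup (FreeGroup α) where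
  carrier := {g | RaisesOrder i ((magnus α g).val - 1)}
  one_mem' := by
    intro d f _ l _
    simp
  mul_mem' {a b} ha hb := by
    have e : (magnus α (a * b)).val - 1 =
        ((magnus α a).val - 1) * (magnus α b).val + ((magnus α b).val - 1) := by
      rw [map_mul, Units.val_mul]; noncomm_ring
    change RaisesOrder i _
    rw [e]
    exact (ha.mul (raisesOrder_magnus b)).add hb
  inv_mem' {a} ha := by
    have e : (magnus α a⁻¹).val - 1 = -(((magnus α a).val - 1) * (magnus α a⁻¹).val) := by
      rw [sub_mul, ← Units.val_mul, ← map_mul, mul_inv_cancel, map_one, Units.val_one]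
      noncomm_ring
    change RaisesOrder i _
    rw [e]
    exact (ha.mul (raisesOrder_magnus a⁻¹)).neg

/-- The orders add in the identity [a,b] - 1 = ((a-1)(b-1) - (b-1)(a-1)) (ba)⁻¹. The shift by one
appears because `Gam` starts at 0 with the whole group, where g - 1 already raises the order by 1.
-/
lemma Gam_le_magnusSubgroup (i : ℕ) : Gam (FreeGroup α) i ≤ magnusSubgroup α (i + 1) := by
  have all : ∀ g : FreeGroup α, RaisesOrder 1 ((magnus α g).val - 1) := by
    intro g
    have h : g ∈ Subgroup.closure (Set.range (FreeGroup.of : α → FreeGroup α)) := by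
      rw [FreeGroup.closure_range_of]; exact Subgroup.mem_top g
    refine (Subgroup.closure_le (magnusSubgroup α 1)).2 ?_ h
    rintro _ ⟨x, rfl⟩
    change RaisesOrder 1 _
    rw [magnus, FreeGroup.lift_apply_of]
    change RaisesOrder 1 (1 + mulVar x - 1)
    rw [add_sub_cancel_left]
    exact raisesOrder_mulVar x
  induction i with
  | zero => exact fun g _ => all g
  | succ i ih =>
    refine (Subgroup.commutator_le).2 fun a ha b _ => ?_
    have ha := ih ha
    change RaisesOrder (i + 1) ((magnus α a).val - 1) at ha
    have hb := all b
    have e : (magnus α ⁅a, b⁆).val - 1 = (((magnus α a).val - 1) * ((magnus α b).val - 1) +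
        -(((magnus α b).val - 1) * ((magnus α a).val - 1))) * (magnus α (b * a)⁻¹).val := by
      have h1 : ⁅a, b⁆ = a * b * (b * a)⁻¹ := by rw [commutatorElement_def]; group
      have h2 : (magnus α (b * a)).val * (magnus α (b * a)⁻¹).val = 1 := by
        rw [← Units.val_mul, ← map_mul, mul_inv_cancel, map_one, Units.val_one]
      have h3 : ((magnus α a).val - 1) * ((magnus α b).val - 1) +
          -(((magnus α b).val - 1) * ((magnus α a).val - 1)) =
          (magnus α (a * b)).val - (magnus α (b * a)).val := by
        rw [map_mul, map_mul, Units.val_mul, Units.val_mul]; noncomm_ring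
      rw [h3, sub_mul, h2, h1, map_mul, Units.val_mul]
    change RaisesOrder (i + 1 + 1) _
    rw [e]
    refine RaisesOrder.mul (j := 0) ((ha.mul hb).add (RaisesOrder.neg ?_)) (raisesOrder_magnus _)
    rw [add_comm]
    exact hb.mul ha

/-- The unit power series. -/
def unitSeries (α : Type*) : List α → ℤ
  | [] => 1
  | _ :: _ => 0

open Monoid in
/-- The coefficient of the product of the letters of a reduced word in its Magnus expansion is not
zero, and longer words do not occur. -/
lemma magnus_word (w : CoprodI.Word fun _ : α => FreeGroup Unit) :
    (magnus α (freeGroupEquivCoprodI.symm w.prod)).val (unitSeries α)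
      (w.toList.map Sigma.fst) ≠ 0 ∧
    ∀ l : List α, w.toList.length < l.length →
      (magnus α (freeGroupEquivCoprodI.symm w.prod)).val (unitSeries α) l = 0 := by
  induction w using CoprodI.Word.consRecOn with
  | empty =>
    rw [CoprodI.Word.prod_empty, map_one, map_one]
    refine ⟨one_ne_zero, ?_⟩
    rintro (_ | ⟨y, t⟩) hl
    · simp at hl
    · rfl
  | cons x m w h1 h2 ih =>
    -- A reduced word in the free product is a product of nonzero powers x^k with adjacent letters
    -- distinct, and each syllable acts as 1 + kx.
    obtain ⟨k, rfl⟩ := FreeGroup.freeGroupUnitEquivInt.symm.surjective m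
    have hk : k ≠ 0 := by
      rintro rfl
      exact h2 rfl
    have e : freeGroupEquivCoprodI.symm (CoprodI.Word.cons (M := fun _ : α => FreeGroup Unit)
        (FreeGroup.freeGroupUnitEquivInt.symm k) w h1 h2).prod =
        FreeGroup.of x ^ k * freeGroupEquivCoprodI.symm w.prod := by
      rw [CoprodI.Word.prod_cons, map_mul]
      congr 1
      have e0 : freeGroupEquivCoprodI (FreeGroup.of x) =
          CoprodI.of (M := fun _ : α => FreeGroup Unit) (i := x) (FreeGroup.of ()) := by simp
      rw [MulEquiv.symm_apply_eq, map_zpow, e0]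
      exact map_zpow (CoprodI.of (M := fun _ : α => FreeGroup Unit) (i := x)) _ _
    set f := (magnus α (freeGroupEquivCoprodI.symm w.prod)).val (unitSeries α)
    have e' : (magnus α (freeGroupEquivCoprodI.symm (CoprodI.Word.cons
        (M := fun _ : α => FreeGroup Unit)
        (FreeGroup.freeGroupUnitEquivInt.symm k) w h1 h2).prod)).val (unitSeries α) =
        f + k • mulVar x f := by
      rw [e, map_mul, map_zpow, Units.val_mul, Module.End.mul_apply, magnus,
        FreeGroup.lift_apply_of, oneAddVar_zpow]
      rfl
    rw [e']
    constructor
    · change f (x :: w.toList.map Sigma.fst) + k • mulVar x f (x :: w.toList.map Sigma.fst) ≠ 0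
      -- The extended word is too long to occur in `f`, so its coefficient is k times the previous
      -- leading coefficient. Thus the leading coefficient is the product of the exponents.
      rw [ih.2 _ (by simp), zero_add, mulVar_cons, if_pos]
      · simpa using ⟨hk, ih.1⟩
      · refine ⟨rfl, ?_⟩
        rw [List.head?_map]
        exact h1
    · rintro (_ | ⟨y, t⟩) hl
      · simp at hl
      · have hl' : w.toList.length + 1 < t.length + 1 := hl
        change f (y :: t) + k • mulVar x f (y :: t) = 0
        rw [ih.2 _ (by simp only [List.length_cons]; omega), mulVar_cons]
        split_ifs
        · rw [ih.2 _ (by omega)]; simp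
        · simp

open Monoid in
/-- Free groups are residually nilpotent. -/
theorem FreeGroup.eq_one_of_forall_mem_Gam {g : FreeGroup α} (h : ∀ i, g ∈ Gam (FreeGroup α) i) :
    g = 1 := by
  have hg : (magnus α g).val (unitSeries α) = unitSeries α := by
    funext l
    -- The stage is chosen to depend on the word: index `l.length` forces agreement with the unit
    -- series up to and including length `l.length`.
    have := Gam_le_magnusSubgroup l.length (h l.length) 0 (unitSeries α) (by simp) l (by omega)
    rwa [LinearMap.sub_apply, Pi.sub_apply, sub_eq_zero] at this
  let w := CoprodI.Word.equiv (freeGroupEquivCoprodI g)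
  have hw : w.prod = freeGroupEquivCoprodI g := CoprodI.Word.equiv.symm_apply_apply _
  have h1 := (magnus_word w).1
  rw [hw, MulEquiv.symm_apply_apply, hg] at h1
  -- The leading coefficient is nonzero, but the unit series vanishes at nonempty words.
  have h2 : w.toList = [] := by
    rcases hl : w.toList with _ | ⟨y, t⟩
    · rfl
    · rw [hl] at h1; exact absurd rfl h1
  have h3 : w.prod = 1 := by rw [CoprodI.Word.prod, h2]; rfl
  rw [hw] at h3
  exact (map_eq_one_iff _ freeGroupEquivCoprodI.injective).1 h3

end ResiduallyNilpotent

/-! ### The crossed homomorphism on cabled braids and the proof of the theorem. -/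

section Cabling

variable {n : ℕ}

/-- The crossed homomorphism `P_{n+1} → F` given by the framing of the first strand. -/
def strandFrame (b : PureBraid (n + 1)) : FreeGroup (Fin n) := (frame b.1 0)⁻¹

/-- Artin's action of the pure braid group. -/
def pureAct (n : ℕ) : PureBraid (n + 1) →* MulAut (FreeGroup (Fin n)) :=
  (artinAct n).comp (PureBraid (n + 1)).subtype

/-- Taking the inverse of the frame reverses the order of the factors in `frame_mul`, and purity
keeps the strand in position 0. -/
lemma strandFrame_mul (a b : PureBraid (n + 1)) :
    strandFrame (a * b) = strandFrame a * pureAct n a (strandFrame b) := by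
  change (frame (a.1 * b.1) 0)⁻¹ = (frame a.1 0)⁻¹ * artinAct n a.1 (frame b.1 0)⁻¹
  rw [frame_mul, MonoidHom.mem_ker.1 b.2, mul_inv_rev, map_inv]
  rfl

lemma strandFrame_mem_Gam {i : ℕ} {b : PureBraid (n + 1)} (hb : b ∈ Gam (PureBraid (n + 1)) i) :
    strandFrame b ∈ Gam (FreeGroup (Fin n)) i :=
  crossedHom_mem_Gam (pureAct n) (fun g a => artinAct_pure g.2 a) strandFrame strandFrame_mul hb

/-- The crossed homomorphism `strandFrame` on cabled braids. -/
def cablingFrame (w : FreeGroup (Fin n)) : FreeGroup (Fin n) := strandFrame (cablingHom n w)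

lemma cablingFrame_mul (a b : FreeGroup (Fin n)) : cablingFrame (a * b) =
    cablingFrame a * pureAct n (cablingHom n a) (cablingFrame b) := by
  rw [cablingFrame, map_mul, strandFrame_mul]; rfl

lemma cablingFrame_one : cablingFrame (1 : FreeGroup (Fin n)) = 1 := by
  rw [cablingFrame, map_one]
  exact inv_eq_one.2 (frame_one 0)

/-- The indices run oppositely: the free generators count strands of the second ribbon, the loops
those of the first. -/
lemma cablingHom_of_rev {k : ℕ} (hk : k < n) :
    (cablingHom n (FreeGroup.of ⟨n - 1 - k, by omega⟩)).1 = ribbonTwist n (k + 1) := by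
  rw [cablingHom, FreeGroup.lift_apply_of, cabledTwist_eq_ribbonTwist]
  congr 1
  simp only
  omega

lemma cablingFrame_of_rev {k : ℕ} (hk : k < n) :
    cablingFrame (FreeGroup.of (⟨n - 1 - k, by omega⟩ : Fin n)) = loopAround n (k + 1) := by
  rw [cablingFrame, strandFrame, cablingHom_of_rev hk, frame_ribbonTwist (by omega) (by omega),
    if_pos (by omega), inv_inv]

/-- Left multiplication of the argument by a free generator becomes a ↦ X_k D_k(a) on the values.
The range is thus stable under these moves and their inverses, and `subset_of_twist` applies. -/
theorem cablingFrame_surjective (n : ℕ) :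
    Function.Surjective (cablingFrame : FreeGroup (Fin n) → FreeGroup (Fin n)) := by
  intro a
  refine (isTwistFamily_ribbonTwist n).subset_of_twist le_rfl (Set.range cablingFrame)
    ⟨1, cablingFrame_one⟩ (fun k hk a => ?_) (by rw [closure_loopAround]; exact Subgroup.mem_top a)
  set y : FreeGroup (Fin n) := FreeGroup.of ⟨n - 1 - k, by omega⟩
  have hy : pureAct n (cablingHom n y) = artinAct n (ribbonTwist n (k + 1)) :=
    congrArg (artinAct n) (cablingHom_of_rev hk)
  have key : ∀ a, loopAround n (k + 1) * artinAct n (ribbonTwist n (k + 1)) (cablingFrame a) =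
      cablingFrame (y * a) := by
    intro a
    rw [cablingFrame_mul, hy, cablingFrame_of_rev hk]
  constructor
  · rintro ⟨b, hb⟩
    refine ⟨y⁻¹ * b, ?_⟩
    have := key (y⁻¹ * b)
    rw [mul_inv_cancel_left, hb] at this
    exact (artinAct n (ribbonTwist n (k + 1))).injective (mul_left_cancel this)
  · rintro ⟨b, rfl⟩
    exact ⟨y * b, (key b).symm⟩

lemma cablingFrame_mem_Gam {i : ℕ} {w : FreeGroup (Fin n)}
    (hw : cablingFrame w ∈ Gam (FreeGroup (Fin n)) i) : w ∈ Gam (FreeGroup (Fin n)) i := by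
  -- Additivity on the graded pieces: v(gh) and v(g)v(h) differ only by the action of Θ(g) on v(h),
  -- which is trivial modulo the next stage.
  refine mem_Gam_of_surjective cablingFrame (cablingFrame_surjective n)
    (fun hg => strandFrame_mem_Gam (Gam_map _ hg)) (fun {i g h} hg hh => ?_) hw
  have h1 : cablingFrame h ∈ Gam (FreeGroup (Fin n)) i := strandFrame_mem_Gam (Gam_map _ hh)
  have h2 := action_mul_inv_mem_Gam (pureAct n) (fun g a => artinAct_pure g.2 a)
    (Gam_map (cablingHom n) hg) h1
  have h3 := (⊤ : Subgroup (FreeGroup (Fin n))).lowerCentralSeries_antitone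
    (show i + 1 ≤ i + i + 1 by omega) h2
  have h4 := Gam_conj_mem (cablingFrame h)⁻¹ (inv_mem h3)
  rw [cablingFrame_mul]
  set b := pureAct n (cablingHom n g) (cablingFrame h)
  have h5 := Gam_conj_mem (b⁻¹ * cablingFrame h) h4
  convert h5 using 1
  group

/-- The cabling homomorphism is strict for the descending central series. -/
theorem mem_Gam_of_cablingHom_mem {i : ℕ} {w : FreeGroup (Fin n)}
    (hw : cablingHom n w ∈ Gam (PureBraid (n + 1)) i) : w ∈ Gam (FreeGroup (Fin n)) i :=
  cablingFrame_mem_Gam (strandFrame_mem_Gam hw)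

/-- The class of f(x) vanishes in degree i + 1 exactly when f(x) lies one stage deeper; by the
hypothesis so does x. -/
lemma Gr.map_injective {G H : Type*} [Group G] [Group H] (f : G →* H)
    (hf : ∀ i g, f g ∈ Gam H i → g ∈ Gam G i) : Function.Injective (Gr.map f) := by
  refine DirectSum.map_injective _ |>.2 fun i => ?_
  refine (injective_iff_map_eq_zero _).2 fun a ha => ?_
  obtain ⟨x, hx, rfl⟩ := grCls_surj a
  rw [grPieceMap_cls] at ha
  have h0 : grCls i (f x) (Gam_map f hx) = grCls i 1 (one_mem _) := ha
  rw [eq_comm, grCls_eq, inv_one, one_mul] at h0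
  exact grCls_eq_zero (hf _ _ h0)

/-- An element of the kernel has its image in every stage, so by strictness it lies in every stage
itself; residual nilpotence finishes. -/
theorem cablingHom_injective (n : ℕ) : Function.Injective (cablingHom n) := by
  refine (injective_iff_map_eq_one _).2 fun w hw => ?_
  refine FreeGroup.eq_one_of_forall_mem_Gam fun i => mem_Gam_of_cablingHom_mem ?_
  rw [hw]
  exact one_mem _

/-- `P_2` is generated by the full twist. -/
lemma exists_zpow_fullTwist (b : PureBraid 2) : ∃ k : ℤ, fullTwist ^ k = b := by
  have cyc : ∀ b : BraidGroup 2, ∃ k : ℤ, braidGen 2 0 ^ k = b := by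
    intro b
    induction b using BraidGroup.induction with
    | one => exact ⟨0, zpow_zero _⟩
    | gen i h =>
      obtain rfl : i = 0 := by omega
      exact ⟨1, zpow_one _⟩
    | mul a b ha hb =>
      obtain ⟨k, rfl⟩ := ha
      obtain ⟨l, rfl⟩ := hb
      exact ⟨k + l, zpow_add _ _ _⟩
    | inv a ha =>
      obtain ⟨k, rfl⟩ := ha
      exact ⟨-k, zpow_neg _ _⟩
  obtain ⟨b, hb⟩ := b
  obtain ⟨k, rfl⟩ := cyc b
  rw [MonoidHom.mem_ker, map_zpow, braidPerm_gen (by omega)] at hb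
  have hs : Equiv.swap 0 (0 + 1) ^ (2 : ℤ) = 1 := by
    rw [zpow_two, Equiv.swap_mul_self]
  obtain ⟨l, rfl | rfl⟩ := Int.even_or_odd' k
  · exact ⟨l, Subtype.ext (by
      change (braidGen 2 0 ^ 2) ^ l = braidGen 2 0 ^ (2 * l)
      rw [zpow_mul]; rfl)⟩
  -- An odd power of the generator exchanges the two strands, so it is not pure.
  · rw [zpow_add, zpow_mul, hs, one_zpow, one_mul, zpow_one] at hb
    have := DFunLike.congr_fun hb 0
    simp at this

/-- Any two strands are separated by some cut into two ribbons; forgetting all other strands then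
turns the cabled twist back into the full twist, which generates P_2. -/
lemma APmap_cablingHom_surjective (i : SimplexCategory.mk 1 ⟶ SimplexCategory.mk n)
    (hi : Function.Injective i.toOrderHom) :
    Function.Surjective fun w => APmap i (cablingHom n w) := by
  have hlt : i.toOrderHom 0 < i.toOrderHom 1 :=
    lt_of_le_of_ne (i.toOrderHom.monotone (Fin.zero_le _)) fun h => by simpa using hi h
  have hlt' : (i.toOrderHom 0 : ℕ) < i.toOrderHom 1 := hlt
  have hn : (i.toOrderHom 1 : ℕ) < n + 1 := (i.toOrderHom 1).2
  -- With this choice the first ribbon has n - q = i(1) strands, so i(0) lies in the first ribbon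
  -- and i(1) is the first strand of the second one.
  let q : Fin n := ⟨n - (i.toOrderHom 1 : ℕ), by omega⟩
  have hq : i ≫ SimplexCategory.toMk₁ (n := n) ⟨n - q, by omega⟩ = 𝟙 _ := by
    refine ConcreteCategory.hom_ext _ _ fun j => ?_
    fin_cases j
    · exact SimplexCategory.toMk₁_of_castSucc_lt _ (i.toOrderHom 0) (Fin.lt_def.2 (by
        change (i.toOrderHom 0 : ℕ) < n - (n - (i.toOrderHom 1 : ℕ)); omega))
    · exact SimplexCategory.toMk₁_of_le_castSucc _ (i.toOrderHom 1) (Fin.le_def.2 (by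
        change n - (n - (i.toOrderHom 1 : ℕ)) ≤ (i.toOrderHom 1 : ℕ); omega))
  have key : APmap i (cablingHom n (FreeGroup.of q)) = fullTwist := by
    rw [cablingHom, FreeGroup.lift_apply_of, cabledTwist]
    refine (APmap_comp i _ fullTwist).symm.trans ?_
    rw [hq, APmap, op_id, AP.map_id]
    rfl
  intro b
  obtain ⟨k, rfl⟩ := exists_zpow_fullTwist b
  refine ⟨FreeGroup.of q ^ k, ?_⟩
  simp only [map_zpow, key]

/-- The form of strictness needed in degree n of the E^0-term, transported along `circleFree`. -/
lemma Gr.map_thetaHom_injective (n : ℕ) :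
    Function.Injective (Gr.map (thetaHom (op (SimplexCategory.mk n)))) := by
  refine Gr.map_injective _ fun i g hg => ?_
  obtain ⟨w, rfl⟩ := (circleFree_bijective n).2 g
  rw [thetaHom_circleFree] at hg
  exact Gam_map _ (mem_Gam_of_cablingHom_mem hg)

end Cabling

theorem mainTheorem1 (n : ℕ) :
    Function.Injective (Gr.map (cablingHom n)) ∧
    Function.Injective (cablingHom n) ∧
    (∀ i : SimplexCategory.mk 1 ⟶ SimplexCategory.mk n, Function.Injective i.toOrderHom →
      Function.Surjective fun w => APmap i (cablingHom n w)) ∧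
    Function.Injective
      (LieZ.toLieHom ((EZero.map Theta).app (op (SimplexCategory.mk n)))) :=
  ⟨Gr.map_injective _ fun _ _ => mem_Gam_of_cablingHom_mem, cablingHom_injective n,
    APmap_cablingHom_surjective, Gr.map_thetaHom_injective n⟩
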